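/- A plane binary tree is a rooted tree in which every vertex has either no children (a leaf) or exactly two children, one designated left and one right. For $n\ge 1$ let $\mathcal{B}_n$ be the set of binary trees with $n$ leaves, i.e. of plane binary trees with $n$ leaves up to equivalence, where two plane binary trees are equivalent if there is a graph isomorphism between them that maps root to root. A tanglegram of size $n$ consists of two binary trees with $n$ leaves each, a left one and a right one, together with a perfect matching between the leaves of the left tree and the leaves of the right tree; two tanglegrams are the same if there are root-preserving isomorphisms, one between the left trees and one between the right trees, that together carry the one matching to the other. Let $\nu^T_n$ be the probability measure on $\mathcal{B}_n^2$ that is the law of the pair (left tree, right tree) of a uniformly random tanglegram of size $n$, and let $\nu^P_n$ be the probability measure on $\mathcal{B}_n^2$ that is the law of the pair of binary trees (equivalence classes) represented by two plane binary trees with $n$ leaves chosen uniformly and independently at random. Let $d(\pi_1,\pi_2)=\sup_S|\pi_1(S)-\pi_2(S)|$ denote the total variation distance. **Theorem.** The total variation distance $d(\nu^T_n,\nu^P_n)$ tends to $0$ as $n\to\infty$; specifically, $d(\nu^T_n,\nu^P_n)=O(n^{-1/2})$. Moreover, there exist absolute constants $M_1,M_2>0$ and $C$ such that for every $n\ge 1$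 and every subset $S$ of $\mathcal{B}_n^2$, $$\nu^T_n(S)\le M_1\,\nu^P_n(S)+C\,n^{-1}\qquad\text{and}\qquad \nu^P_n(S)\le M_2\,\nu^T_n(S)+C\,n^{-1}.$$ -/

import Mathlib

open MeasureTheory ProbabilityTheory Filter

/-- The vertices of a plane binary tree. Here `BinaryTree.nil` is the tree consisting of a
single leaf, and `BinaryTree.node () l r` is the tree whose root is an internal vertex with left
branch `l` and right branch `r`. -/
inductive Vertex : BinaryTree Unit → Type
  | root (t : BinaryTree Unit) : Vertex t
  | inLeft {a : Unit} {l r : BinaryTree Unit} (v : Vertex l) : Vertex (.node a l r)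
  | inRight {a : Unit} {l r : BinaryTree Unit} (v : Vertex r) : Vertex (.node a l r)

/-- `IsParent v w`: the vertex `w` is a child of the vertex `v`. -/
inductive IsParent : {t : BinaryTree Unit} → Vertex t → Vertex t → Prop
  | rootLeft (a : Unit) (l r : BinaryTree Unit) :
      IsParent (Vertex.root (.node a l r)) (Vertex.inLeft (Vertex.root l))
  | rootRight (a : Unit) (l r : BinaryTree Unit) :
      IsParent (Vertex.root (.node a l r)) (Vertex.inRight (Vertex.root r))
  | inLeft {a : Unit} {l r : BinaryTree Unit} {v w : Vertex l} (h : IsParent v w) :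
      IsParent (Vertex.inLeft (a := a) (r := r) v) (Vertex.inLeft w)
  | inRight {a : Unit} {l r : BinaryTree Unit} {v w : Vertex r} (h : IsParent v w) :
      IsParent (Vertex.inRight (a := a) (l := l) v) (Vertex.inRight w)

/-- The underlying graph of a plane binary tree: each vertex is joined to its children. -/
def treeGraph (t : BinaryTree Unit) : SimpleGraph (Vertex t) :=
  SimpleGraph.fromRel IsParent

/-- The leaves of a plane binary tree: the vertices with no children. -/
abbrev Leaf (t : BinaryTree Unit) : Type :=
  {v : Vertex t // ∀ w, ¬ IsParent v w}

/-- Isomorphisms of rooted trees: graph isomorphisms that map the root to the root. -/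
structure RootedIso (s t : BinaryTree Unit) where
  iso : treeGraph s ≃g treeGraph t
  map_root : iso (Vertex.root s) = Vertex.root t

namespace RootedIso

def refl (s : BinaryTree Unit) : RootedIso s s :=
  ⟨RelIso.refl _, rfl⟩

def symm {s t : BinaryTree Unit} (φ : RootedIso s t) : RootedIso t s :=
  ⟨φ.iso.symm, by rw [← φ.map_root, RelIso.symm_apply_apply]⟩

def trans {s t u : BinaryTree Unit} (φ : RootedIso s t) (ψ : RootedIso t u) : RootedIso s u :=
  ⟨φ.iso.trans ψ.iso, by rw [RelIso.trans_apply, φ.map_root, ψ.map_root]⟩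

end RootedIso

/-- Plane binary trees with `n` leaves. -/
structure PlaneTree (n : ℕ) where
  tree : BinaryTree Unit
  numLeaves_eq : tree.numLeaves = n

/-- Two plane binary trees are equivalent if they are isomorphic as rooted graphs. -/
instance planeTreeSetoid (n : ℕ) : Setoid (PlaneTree n) where
  r s t := Nonempty (RootedIso s.tree t.tree)
  iseqv :=
    { refl := fun s => ⟨RootedIso.refl s.tree⟩
      symm := fun ⟨φ⟩ => ⟨φ.symm⟩
      trans := fun ⟨φ⟩ ⟨ψ⟩ => ⟨φ.trans ψ⟩ }

/-- The set of binary trees with `n` leaves: plane binary trees up to equivalence. -/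
def BinTree (n : ℕ) : Type :=
  Quotient (planeTreeSetoid n)

/-- The binary tree represented by a plane binary tree. -/
def PlaneTree.toBinTree {n : ℕ} (t : PlaneTree n) : BinTree n :=
  Quotient.mk (planeTreeSetoid n) t

/-- A representation of a tanglegram of size `n`: two plane binary trees with `n` leaves and a
perfect matching between the leaves of the left tree and the leaves of the right tree. -/
structure TangleRep (n : ℕ) where
  left : PlaneTree n
  right : PlaneTree n
  matching : Leaf left.tree ≃ Leaf right.tree

/-- The vertices `v` of the left tree and `w` of the right tree are leaves matched to
each other. -/
def TangleRep.Matched {n : ℕ} (D : TangleRep n) (v : Vertex D.left.tree) (w : Vertex D.right.tree) :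
    Prop :=
  ∃ x : Leaf D.left.tree, x.1 = v ∧ (D.matching x).1 = w

/-- Two representations give the same tanglegram if there are an isomorphism between the left trees
and an isomorphism between the right trees, both mapping root to root, that together carry
matched leaves exactly to matched leaves. -/
instance tangleSetoid (n : ℕ) : Setoid (TangleRep n) where
  r D E := ∃ (φ : RootedIso D.left.tree E.left.tree) (ψ : RootedIso D.right.tree E.right.tree),
    ∀ v w, D.Matched v w ↔ E.Matched (φ.iso v) (ψ.iso w)
  iseqv :=
    { refl := fun D => ⟨RootedIso.refl _, RootedIso.refl _, fun _ _ => Iff.rfl⟩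
      symm := by
        rintro D E ⟨φ, ψ, h⟩
        refine ⟨φ.symm, ψ.symm, fun v w => ?_⟩
        rw [h]
        change _ ↔ E.Matched (φ.iso (φ.iso.symm v)) (ψ.iso (ψ.iso.symm w))
        rw [RelIso.apply_symm_apply, RelIso.apply_symm_apply]
      trans := by
        rintro D E F ⟨φ, ψ, h⟩ ⟨φ', ψ', h'⟩
        exact ⟨φ.trans φ', ψ.trans ψ', fun v w => (h v w).trans (h' _ _)⟩ }

/-- The set of tanglegrams of size `n`. -/
def Tanglegram (n : ℕ) : Type :=
  Quotient (tangleSetoid n)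

/-- The pair consisting of the left tree and the right tree of a tanglegram. -/
def Tanglegram.halves {n : ℕ} (T : Tanglegram n) : BinTree n × BinTree n :=
  Quotient.lift (s := tangleSetoid n) (fun D => (D.left.toBinTree, D.right.toBinTree))
    (by
      rintro D E ⟨φ, ψ, -⟩
      exact Prod.ext (Quotient.sound ⟨φ⟩) (Quotient.sound ⟨ψ⟩)) T

instance (n : ℕ) : MeasurableSpace (PlaneTree n) := ⊤

instance (n : ℕ) : MeasurableSpace (BinTree n) := ⊤

instance (n : ℕ) : MeasurableSpace (Tanglegram n) := ⊤

/-- The law of the pair (left tree, right tree) of a uniformly random tanglegram of size `n`. -/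
noncomputable def nuT (n : ℕ) : Measure (BinTree n × BinTree n) :=
  (uniformOn (Set.univ : Set (Tanglegram n))).map Tanglegram.halves

/-- The law of the pair of binary trees represented by two independent uniformly random plane
binary trees with `n` leaves. -/
noncomputable def nuP (n : ℕ) : Measure (BinTree n × BinTree n) :=
  ((uniformOn (Set.univ : Set (PlaneTree n))).prod
    (uniformOn (Set.univ : Set (PlaneTree n)))).map
      (fun p => (p.1.toBinTree, p.2.toBinTree))

/-- The total variation distance of two probability measures. -/
noncomputable def tvDist {α : Type*} [MeasurableSpace α] (μ ν : Measure α) : ℝ :=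
  ⨆ S : {S : Set α // MeasurableSet S}, |μ.real S.1 - ν.real S.1|

/-! Matched pairs of plane trees form a finite groupoid whose classes are the tanglegrams. An object
of size `n + 1` has `4 ^ n` outgoing arrows: each of the `n` internal vertices of either tree may
exchange its branches or not. In such a groupoid the automorphism counts over each class add up to
that constant, so `ν^T` is the law of a pair of plane trees `(s, t)` chosen with weight
`intertwineCount s t`, the number of triples (automorphism of `s`, automorphism of `t`, intertwining
bijection of the leaves) (`mul_card_classes`, `card_tanglegram`, `nuT_real`). Since `ν^P` gives all
pairs weight one, it remains to show that the weight divided by `n!`, where `n` now denotes the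
number of leaves, is on average close to a constant.

A permutation with `n - 2q` fixed points has at most `(n - 2q)! 2^q q!` elements in its centralizer,
with equality for involutions. Products of cherry swaps are involutions, and `q` of the `c` cherries
can be chosen in `c.choose q` ways; so these products alone contribute exactly `cherryWeight n c d`,
where `c` and `d` are the numbers of cherries. This is a lower bound for the normalized weight, it
lies between `1` and `e`, and it is close to `exp(2cd/n²)`.

The other automorphisms are negligible on average (`sum_intertwineCount_sub_cherryWeight_le`). An
automorphism is a plane tree whose `m + j` leaves are replaced by `m` fixed leaves and `j` exchanged
pairs of branches. The functional equation `G = W + G²` turns this into an exact formula, in which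
the cherry swaps are the term `j = q` and the terms `j < q` are smaller by a factor of order `1/n`
for fixed `q`; the factor `1/q!` from the centralizers makes the sum over `q` converge.

Finally the number of cherries has mean about `n/4` and variance `O(n)`, so `cherryWeight` is within
`O(n^{-1/2})` of `exp(1/8)` on average. The bounds on the density with the `1/n` error give the two
inequalities between measures, and the concentration gives the total variation bound
(`weighted_vs_uniform`). -/

/-! ### Rooted isomorphisms and the branches at the root. -/

/-- The branches of a node, indexed by `Bool` (`true` is the left branch). -/
abbrev branch (l r : BinaryTree Unit) (b : Bool) : BinaryTree Unit := cond b l r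

/-- The inclusion of a branch of a node. -/
def inBranch (a : Unit) (l r : BinaryTree Unit) :
    ∀ b : Bool, Vertex (branch l r b) → Vertex (.node a l r)
  | true, v => .inLeft v
  | false, v => .inRight v

theorem inBranch_injective {a : Unit} {l r : BinaryTree Unit} {b c : Bool}
    {v : Vertex (branch l r b)} {w : Vertex (branch l r c)}
    (h : inBranch a l r b v = inBranch a l r c w) : ∃ e : b = c, e ▸ v = w := by
  cases b <;> cases c <;> simp_all [inBranch]

theorem inBranch_inj {a : Unit} {l r : BinaryTree Unit} {b : Bool}
    {v w : Vertex (branch l r b)} : inBranch a l r b v = inBranch a l r b w ↔ v = w := by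
  cases b <;> simp [inBranch]

theorem inBranch_ne_root {a : Unit} {l r : BinaryTree Unit} {b : Bool}
    {v : Vertex (branch l r b)} : inBranch a l r b v ≠ .root _ := by
  cases b <;> simp [inBranch]

theorem isParent_inBranch_iff {a : Unit} {l r : BinaryTree Unit} {b : Bool}
    {v : Vertex (branch l r b)} {w : Vertex (.node a l r)} :
    IsParent (inBranch a l r b v) w ↔ ∃ w', w = inBranch a l r b w' ∧ IsParent v w' := by
  constructor
  · intro h
    cases b
    · simp only [inBranch] at h ⊢
      cases h with
      | inRight h => exact ⟨_, rfl, h⟩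
    · simp only [inBranch] at h ⊢
      cases h with
      | inLeft h => exact ⟨_, rfl, h⟩
  · rintro ⟨w', rfl, h⟩
    cases b
    · exact .inRight h
    · exact .inLeft h

theorem isParent_root_iff {a : Unit} {l r : BinaryTree Unit} {w : Vertex (.node a l r)} :
    IsParent (.root _) w ↔ ∃ b, w = inBranch a l r b (.root _) := by
  constructor
  · intro h
    cases h with
    | rootLeft => exact ⟨true, rfl⟩
    | rootRight => exact ⟨false, rfl⟩
  · rintro ⟨b, rfl⟩
    cases b
    · exact .rootRight a l r
    · exact .rootLeft a l r

theorem not_isParent_root {t : BinaryTree Unit} (v : Vertex t) : ¬ IsParent v (.root t) := by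
  intro h
  cases h

theorem IsParent.ne {t : BinaryTree Unit} {v w : Vertex t} (h : IsParent v w) : v ≠ w := by
  induction h <;> simp_all

theorem treeGraph_adj {t : BinaryTree Unit} {v w : Vertex t} :
    (treeGraph t).Adj v w ↔ IsParent v w ∨ IsParent w v := by
  simp only [treeGraph, SimpleGraph.fromRel_adj]
  constructor
  · exact fun h => h.2
  · rintro (h | h)
    · exact ⟨h.ne, .inl h⟩
    · exact ⟨h.ne.symm, .inr h⟩

theorem treeGraph_adj_inBranch {a : Unit} {l r : BinaryTree Unit} {b : Bool}
    {v w : Vertex (branch l r b)} :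
    (treeGraph (.node a l r)).Adj (inBranch a l r b v) (inBranch a l r b w) ↔
      (treeGraph (branch l r b)).Adj v w := by
  simp [treeGraph_adj, isParent_inBranch_iff, inBranch_inj]

theorem vertex_cases {a : Unit} {l r : BinaryTree Unit} (w : Vertex (.node a l r)) :
    w = .root _ ∨ ∃ b v, w = inBranch a l r b v := by
  cases w with
  | root => exact .inl rfl
  | inLeft v => exact .inr ⟨true, v, rfl⟩
  | inRight v => exact .inr ⟨false, v, rfl⟩

theorem eq_inBranch_of_adj {a : Unit} {l r : BinaryTree Unit} {b : Bool}
    {v : Vertex (branch l r b)} {w : Vertex (.node a l r)} (hw : w ≠ .root _)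
    (h : (treeGraph (.node a l r)).Adj (inBranch a l r b v) w) : ∃ w', w = inBranch a l r b w' := by
  obtain rfl | ⟨c, w', rfl⟩ := vertex_cases w
  · exact absurd rfl hw
  · rw [treeGraph_adj, isParent_inBranch_iff, isParent_inBranch_iff] at h
    rcases h with ⟨u, hu, -⟩ | ⟨u, hu, -⟩
    · exact ⟨u, hu⟩
    · obtain ⟨rfl, -⟩ := inBranch_injective hu
      exact ⟨w', rfl⟩

/-- Connectedness of the tree as an induction principle: properties of an isomorphism, which only
respects adjacency, can be propagated from the root along edges. -/
theorem vertex_induction {t : BinaryTree Unit} (P : Vertex t → Prop) (h0 : P (.root t))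
    (h : ∀ v w, (treeGraph t).Adj v w → P v → P w) (v : Vertex t) : P v := by
  induction v with
  | root => exact h0
  | @inLeft a l r v ih =>
    refine ih (fun v => P (.inLeft v)) ?_ fun v w hvw =>
      h _ _ (treeGraph_adj_inBranch (b := true) (v := v).2 hvw)
    exact h _ _ (treeGraph_adj.2 (.inl (.rootLeft a l r))) h0
  | @inRight a l r v ih =>
    refine ih (fun v => P (.inRight v)) ?_ fun v w hvw =>
      h _ _ (treeGraph_adj_inBranch (b := false) (v := v).2 hvw)
    exact h _ _ (treeGraph_adj.2 (.inl (.rootRight a l r))) h0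

namespace RootedIso

theorem apply_eq_root_iff {s t : BinaryTree Unit} (φ : RootedIso s t) (v : Vertex s) :
    φ.iso v = .root t ↔ v = .root s := by
  rw [← φ.map_root]
  exact φ.iso.injective.eq_iff

/-- Moving along edges inside a branch never meets the root. The image path therefore avoids the
root too, and it cannot leave the branch in which it started. -/
theorem exists_inBranch {a b : Unit} {l r l' r' : BinaryTree Unit}
    (φ : RootedIso (.node a l r) (.node b l' r')) {c d : Bool}
    (h : φ.iso (inBranch a l r c (.root _)) = inBranch b l' r' d (.root _))
    (v : Vertex (branch l r c)) : ∃ w, φ.iso (inBranch a l r c v) = inBranch b l' r' d w := by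
  refine vertex_induction (fun v => ∃ w, φ.iso (inBranch a l r c v) = inBranch b l' r' d w)
    ⟨_, h⟩ (fun v w hvw => ?_) v
  rintro ⟨v', hv'⟩
  refine eq_inBranch_of_adj (v := v') ?_ ?_
  · rw [Ne, apply_eq_root_iff]
    exact inBranch_ne_root
  · rw [← hv', φ.iso.map_adj_iff]
    exact treeGraph_adj_inBranch.2 hvw

theorem exists_branch {a b : Unit} {l r l' r' : BinaryTree Unit}
    (φ : RootedIso (.node a l r) (.node b l' r')) {c d : Bool}
    (h : φ.iso (inBranch a l r c (.root _)) = inBranch b l' r' d (.root _)) :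
    ∃ ψ : RootedIso (branch l r c) (branch l' r' d),
      ∀ v, φ.iso (inBranch a l r c v) = inBranch b l' r' d (ψ.iso v) := by
  have h' : φ.symm.iso (inBranch b l' r' d (.root _)) = inBranch a l r c (.root _) := by
    rw [← h]
    exact φ.iso.symm_apply_apply _
  choose f hf using φ.exists_inBranch h
  choose g hg using φ.symm.exists_inBranch h'
  have hg' : ∀ w, φ.iso (inBranch a l r c (g w)) = inBranch b l' r' d w := fun w => by
    rw [← hg]
    exact φ.iso.apply_symm_apply _
  have hgf : ∀ v, g (f v) = v := fun v => by
    refine (inBranch_inj (a := a) (l := l) (r := r)).1 (φ.iso.injective ?_)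
    rw [hg', hf]
  have hfg : ∀ v, f (g v) = v := fun v => by
    refine (inBranch_inj (a := b) (l := l') (r := r')).1 ?_
    rw [← hf, hg']
  refine ⟨⟨⟨⟨f, g, hgf, hfg⟩, fun {v w} => ?_⟩, ?_⟩, hf⟩
  · change (treeGraph _).Adj (f v) (f w) ↔ _
    rw [← treeGraph_adj_inBranch (a := b) (l := l') (r := r'), ← hf, ← hf, φ.iso.map_adj_iff,
      treeGraph_adj_inBranch]
  · change f _ = _
    refine (inBranch_inj (a := b) (l := l') (r := r')).1 ?_
    rw [← hf, h]

/-- The neighbours of the root are its two children, so they are mapped to the two children; `d =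
true` when the branches keep their sides and `d = false` when they are exchanged. -/
theorem exists_branches {a b : Unit} {l r l' r' : BinaryTree Unit}
    (φ : RootedIso (.node a l r) (.node b l' r')) :
    ∃ d : Bool, ∃ ψ : RootedIso l (branch l' r' d), ∃ χ : RootedIso r (branch l' r' !d),
      (∀ v, φ.iso (.inLeft v) = inBranch b l' r' d (ψ.iso v)) ∧
      ∀ v, φ.iso (.inRight v) = inBranch b l' r' (!d) (χ.iso v) := by
  have key : ∀ c, ∃ d, φ.iso (inBranch a l r c (.root _)) = inBranch b l' r' d (.root _) := by
    intro c
    have h : (treeGraph (.node a l r)).Adj (.root _) (inBranch a l r c (.root _)) :=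
      treeGraph_adj.2 (.inl (isParent_root_iff.2 ⟨c, rfl⟩))
    rw [← φ.iso.map_adj_iff, φ.map_root, treeGraph_adj] at h
    rcases h with h | h
    · exact isParent_root_iff.1 h
    · exact absurd h (not_isParent_root _)
  obtain ⟨d, hd⟩ := key true
  obtain ⟨e, he⟩ := key false
  have hde : e = !d := by
    by_contra hne
    have : e = d := by cases e <;> cases d <;> simp_all
    subst this
    have := φ.iso.injective (hd.trans he.symm)
    simp [inBranch] at this
  subst hde
  obtain ⟨ψ, hψ⟩ := φ.exists_branch hd
  obtain ⟨χ, hχ⟩ := φ.exists_branch he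
  exact ⟨d, ψ, χ, hψ, hχ⟩

/-- Two isomorphisms of branches give an isomorphism of trees. -/
theorem exists_node (a b : Unit) {l r l' r' : BinaryTree Unit} (d : Bool)
    (ψ : RootedIso l (branch l' r' d)) (χ : RootedIso r (branch l' r' !d)) :
    ∃ φ : RootedIso (.node a l r) (.node b l' r'),
      (∀ v, φ.iso (.inLeft v) = inBranch b l' r' d (ψ.iso v)) ∧
      ∀ v, φ.iso (.inRight v) = inBranch b l' r' (!d) (χ.iso v) := by
  have mk : ∀ {a b : Unit} {l r l' r' : BinaryTree Unit} (d : Bool)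
      (ψ : RootedIso l (branch l' r' d)) (χ : RootedIso r (branch l' r' !d)),
      ∃ f : Vertex (.node a l r) → Vertex (.node b l' r'), f (.root _) = .root _ ∧
      (∀ v, f (.inLeft v) = inBranch b l' r' d (ψ.iso v)) ∧
      ∀ v, f (.inRight v) = inBranch b l' r' (!d) (χ.iso v) := by
    intro a b l r l' r' d ψ χ
    exact ⟨fun v => match v with
      | .root _ => .root _
      | .inLeft v => inBranch b l' r' d (ψ.iso v)
      | .inRight v => inBranch b l' r' (!d) (χ.iso v), rfl, fun _ => rfl, fun _ => rfl⟩
  obtain ⟨f, f0, f1, f2⟩ := mk (a := a) (b := b) d ψ χ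
  have hinj : Function.Injective f := by
    intro v w h
    cases v <;> cases w <;> simp only [f0, f1, f2] at h
    · rfl
    · exact absurd h.symm inBranch_ne_root
    · exact absurd h.symm inBranch_ne_root
    · exact absurd h inBranch_ne_root
    · rw [inBranch_inj] at h
      rw [ψ.iso.injective h]
    · obtain ⟨h, -⟩ := inBranch_injective h
      simp at h
    · exact absurd h inBranch_ne_root
    · obtain ⟨h, -⟩ := inBranch_injective h
      simp at h
    · rw [inBranch_inj] at h
      rw [χ.iso.injective h]
  have hsurj : Function.Surjective f := by
    intro w
    obtain rfl | ⟨e, v, rfl⟩ := vertex_cases w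
    · exact ⟨_, f0⟩
    · by_cases he : e = d
      · subst he
        exact ⟨.inLeft (ψ.iso.symm v), by rw [f1, RelIso.apply_symm_apply]⟩
      · have : e = !d := by cases e <;> cases d <;> simp_all
        subst this
        exact ⟨.inRight (χ.iso.symm v), by rw [f2, RelIso.apply_symm_apply]⟩
  have hparent : ∀ v w, (treeGraph _).Adj (f v) (f w) ↔ (treeGraph _).Adj v w := by
    have hroot : ∀ w, (treeGraph _).Adj (f (.root _)) (f w) ↔ (treeGraph _).Adj (.root _) w := by
      intro w
      have hne : ∀ {d : Bool} (w : Vertex (branch l' r' d)),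
          IsParent (Vertex.root (.node b l' r')) (inBranch b l' r' d w) ↔ w = .root _ := by
        intro d w
        rw [isParent_root_iff]
        constructor
        · rintro ⟨e, he⟩
          obtain ⟨rfl, h⟩ := inBranch_injective he
          exact h
        · rintro rfl
          exact ⟨d, rfl⟩
      have hne' : ∀ {d : Bool} (w : Vertex (branch l r d)),
          IsParent (Vertex.root (.node a l r)) (inBranch a l r d w) ↔ w = .root _ := by
        intro d w
        rw [isParent_root_iff]
        constructor
        · rintro ⟨e, he⟩
          obtain ⟨rfl, h⟩ := inBranch_injective he
          exact h
        · rintro rfl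
          exact ⟨d, rfl⟩
      rw [f0]
      cases w with
      | root => simp [f0]
      | inLeft w =>
        rw [f1]
        simp only [treeGraph_adj, not_isParent_root, or_false]
        rw [hne, apply_eq_root_iff]
        exact (hne' (d := true) w).symm
      | inRight w =>
        rw [f2]
        simp only [treeGraph_adj, not_isParent_root, or_false]
        rw [hne, apply_eq_root_iff]
        exact (hne' (d := false) w).symm
    have hcross : ∀ (a : Unit) (l r : BinaryTree Unit) (c e : Bool) (v : Vertex (branch l r c))
        (w : Vertex (branch l r e)), c ≠ e →
        ¬ (treeGraph (.node a l r)).Adj (inBranch a l r c v) (inBranch a l r e w) := by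
      intro a l r c e v w hce h
      obtain ⟨u, hu⟩ := eq_inBranch_of_adj inBranch_ne_root h
      obtain ⟨h, -⟩ := inBranch_injective hu
      exact hce h.symm
    intro v w
    cases v with
    | root => exact hroot w
    | inLeft v =>
      cases w with
      | root => rw [SimpleGraph.adj_comm, hroot, SimpleGraph.adj_comm]
      | inLeft w =>
        rw [f1, f1, treeGraph_adj_inBranch, ψ.iso.map_adj_iff]
        exact (treeGraph_adj_inBranch (a := a) (l := l) (r := r) (b := true)).symm
      | inRight w =>
        rw [f1, f2]
        exact iff_of_false (hcross _ _ _ _ _ _ _ (by simp))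
          (hcross a l r true false v w (by simp))
    | inRight v =>
      cases w with
      | root => rw [SimpleGraph.adj_comm, hroot, SimpleGraph.adj_comm]
      | inLeft w =>
        rw [f1, f2]
        exact iff_of_false (hcross _ _ _ _ _ _ _ (by simp))
          (hcross a l r false true v w (by simp))
      | inRight w =>
        rw [f2, f2, treeGraph_adj_inBranch, χ.iso.map_adj_iff]
        exact (treeGraph_adj_inBranch (a := a) (l := l) (r := r) (b := false)).symm
  exact ⟨⟨⟨Equiv.ofBijective f ⟨hinj, hsurj⟩, fun {v w} => hparent v w⟩, f0⟩, f1, f2⟩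

end RootedIso

theorem vertex_nil_eq (v w : Vertex .nil) : v = w := by
  cases v
  cases w
  rfl

/-! ### Recursive leaves, recursive isomorphisms and their agreement with graph isomorphisms. -/

/-- The leaves of a plane binary tree, by recursion on the tree. -/
def Leaves : BinaryTree Unit → Type
  | .nil => Unit
  | .node _ l r => Leaves l ⊕ Leaves r

instance Leaves.instFintype : ∀ t : BinaryTree Unit, Fintype (Leaves t)
  | .nil => inferInstanceAs (Fintype Unit)
  | .node _ l r =>
    letI := Leaves.instFintype l
    letI := Leaves.instFintype r
    inferInstanceAs (Fintype (Leaves l ⊕ Leaves r))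

instance Leaves.instDecidableEq : ∀ t : BinaryTree Unit, DecidableEq (Leaves t)
  | .nil => inferInstanceAs (DecidableEq Unit)
  | .node _ l r =>
    letI := Leaves.instDecidableEq l
    letI := Leaves.instDecidableEq r
    inferInstanceAs (DecidableEq (Leaves l ⊕ Leaves r))

theorem Leaves.card (t : BinaryTree Unit) : Fintype.card (Leaves t) = t.numLeaves := by
  induction t with
  | nil => rfl
  | node a l r hl hr =>
    rw [BinaryTree.numLeaves, ← hl, ← hr]
    exact Fintype.card_sum

instance Leaves.instNonempty : ∀ t : BinaryTree Unit, Nonempty (Leaves t)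
  | .nil => ⟨()⟩
  | .node _ l _ =>
    haveI := Leaves.instNonempty l
    ⟨.inl (Classical.arbitrary (Leaves l))⟩

/-- The vertex of a plane binary tree that is a given leaf. -/
def Leaves.toVertex : ∀ {t : BinaryTree Unit}, Leaves t → Vertex t
  | .nil, _ => .root _
  | .node _ _ _, .inl x => .inLeft (toVertex x)
  | .node _ _ _, .inr x => .inRight (toVertex x)

theorem Leaves.toVertex_injective {t : BinaryTree Unit} :
    Function.Injective (Leaves.toVertex : Leaves t → Vertex t) := by
  induction t with
  | nil => exact fun _ _ _ => rfl
  | node a l r hl hr =>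
    rintro (x | x) (y | y) h
    · exact congrArg Sum.inl (hl (by simpa [toVertex] using h))
    · simp [toVertex] at h
    · simp [toVertex] at h
    · exact congrArg Sum.inr (hr (by simpa [toVertex] using h))

theorem Leaves.not_isParent_toVertex {t : BinaryTree Unit} (x : Leaves t) (w : Vertex t) :
    ¬ IsParent x.toVertex w := by
  induction t with
  | nil =>
    intro h
    cases w
    exact h.ne rfl
  | node a l r hl hr =>
    intro h
    rcases x with x | x
    · obtain ⟨w, -, h⟩ := (isParent_inBranch_iff (b := true)).1 h
      exact hl x w h
    · obtain ⟨w, -, h⟩ := (isParent_inBranch_iff (b := false)).1 h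
      exact hr x w h

theorem Leaves.exists_toVertex {t : BinaryTree Unit} (v : Vertex t)
    (h : ∀ w, ¬ IsParent v w) : ∃ x : Leaves t, x.toVertex = v := by
  induction v with
  | root t =>
    cases t with
    | nil => exact ⟨(), rfl⟩
    | node a l r => exact absurd (.rootLeft a l r) (h _)
  | inLeft v ih =>
    obtain ⟨x, hx⟩ := ih fun w hw => h _ (.inLeft hw)
    exact ⟨.inl x, congrArg _ hx⟩
  | inRight v ih =>
    obtain ⟨x, hx⟩ := ih fun w hw => h _ (.inRight hw)
    exact ⟨.inr x, congrArg _ hx⟩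

/-- The recursively defined leaves are the leaves. -/
noncomputable def leafEquiv (t : BinaryTree Unit) : Leaves t ≃ Leaf t :=
  Equiv.ofBijective (fun x => ⟨x.toVertex, x.not_isParent_toVertex⟩)
    ⟨fun _ _ h => Leaves.toVertex_injective (congrArg Subtype.val h), fun v => by
      obtain ⟨x, hx⟩ := Leaves.exists_toVertex v.1 v.2
      exact ⟨x, Subtype.ext hx⟩⟩

theorem leafEquiv_coe {t : BinaryTree Unit} (x : Leaves t) : (leafEquiv t x).1 = x.toVertex := rfl

/-- Isomorphisms of plane binary trees, by recursion on the trees. -/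
def TreeIso : BinaryTree Unit → BinaryTree Unit → Type
  | .nil, .nil => Unit
  | .nil, .node _ _ _ => Empty
  | .node _ _ _, .nil => Empty
  | .node _ l r, .node _ l' r' => (TreeIso l l' × TreeIso r r') ⊕ (TreeIso l r' × TreeIso r l')

instance TreeIso.instFintype : ∀ s t : BinaryTree Unit, Fintype (TreeIso s t)
  | .nil, .nil => inferInstanceAs (Fintype Unit)
  | .nil, .node _ _ _ => inferInstanceAs (Fintype Empty)
  | .node _ _ _, .nil => inferInstanceAs (Fintype Empty)
  | .node _ l r, .node _ l' r' =>
    letI := TreeIso.instFintype l l'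
    letI := TreeIso.instFintype r r'
    letI := TreeIso.instFintype l r'
    letI := TreeIso.instFintype r l'
    inferInstanceAs (Fintype ((TreeIso l l' × TreeIso r r') ⊕ (TreeIso l r' × TreeIso r l')))

namespace TreeIso

/-- The bijection of leaves given by an isomorphism of plane binary trees. -/
def onLeaves : ∀ {s t : BinaryTree Unit}, TreeIso s t → Leaves s ≃ Leaves t
  | .nil, .nil, _ => Equiv.refl Unit
  | .nil, .node _ _ _, e => e.elim
  | .node _ _ _, .nil, e => e.elim
  | .node _ _ _, .node _ _ _, .inl e => Equiv.sumCongr (onLeaves e.1) (onLeaves e.2)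
  | .node _ _ _, .node _ _ _, .inr e =>
    (Equiv.sumCongr (onLeaves e.1) (onLeaves e.2)).trans (Equiv.sumComm _ _)

/-- Every branch contains a leaf, and the image of that leaf reveals whether the branches at the
root were exchanged. -/
theorem onLeaves_injective {s t : BinaryTree Unit} :
    Function.Injective (onLeaves : TreeIso s t → (Leaves s ≃ Leaves t)) := by
  induction s generalizing t with
  | nil =>
    cases t with
    | nil => exact fun _ _ _ => rfl
    | node b l' r' => exact fun e => e.elim
  | node a l r hl hr =>
    cases t with
    | nil => exact fun e => e.elim
    | node b l' r' =>
      have inl : ∀ {e f : TreeIso (.node a l r) (.node b l' r')}, e.onLeaves = f.onLeaves →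
          ∀ x, e.onLeaves (Sum.inl x) = f.onLeaves (Sum.inl x) := fun h x => by rw [h]
      have inr : ∀ {e f : TreeIso (.node a l r) (.node b l' r')}, e.onLeaves = f.onLeaves →
          ∀ x, e.onLeaves (Sum.inr x) = f.onLeaves (Sum.inr x) := fun h x => by rw [h]
      rintro (⟨e, f⟩ | ⟨e, f⟩) (⟨e', f'⟩ | ⟨e', f'⟩) h
      · have he : e = e' := hl (Equiv.ext fun x => Sum.inl_injective (inl h x))
        have hf : f = f' := hr (Equiv.ext fun x => Sum.inr_injective (inr h x))
        rw [he, hf]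
      · exact absurd (inl h (Classical.arbitrary _)) Sum.inl_ne_inr
      · exact absurd (inl h (Classical.arbitrary _)) Sum.inr_ne_inl
      · have he : e = e' := hl (Equiv.ext fun x => Sum.inr_injective (inl h x))
        have hf : f = f' := hr (Equiv.ext fun x => Sum.inl_injective (inr h x))
        rw [he, hf]

theorem exists_of_rootedIso {s t : BinaryTree Unit} (φ : RootedIso s t) :
    ∃ e : TreeIso s t, ∀ x : Leaves s, φ.iso x.toVertex = (e.onLeaves x).toVertex := by
  induction s generalizing t with
  | nil =>
    cases t with
    | nil => exact ⟨(), fun _ => φ.map_root⟩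
    | node b l r =>
      have h : (treeGraph (.node b l r)).Adj (.root _) (.inLeft (.root l)) :=
        treeGraph_adj.2 (.inl (.rootLeft b l r))
      rw [← φ.symm.iso.map_adj_iff] at h
      exact absurd (vertex_nil_eq _ _) h.ne
  | node a l r hl hr =>
    cases t with
    | nil =>
      have h : (treeGraph (.node a l r)).Adj (.root _) (.inLeft (.root l)) :=
        treeGraph_adj.2 (.inl (.rootLeft a l r))
      rw [← φ.iso.map_adj_iff] at h
      exact absurd (vertex_nil_eq _ _) h.ne
    | node b l' r' =>
      obtain ⟨d, ψ, χ, h1, h2⟩ := φ.exists_branches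
      obtain ⟨e, he⟩ := hl ψ
      obtain ⟨f, hf⟩ := hr χ
      cases d
      · refine ⟨.inr (e, f), ?_⟩
        rintro (x | x)
        · exact (h1 _).trans (congrArg _ (he x))
        · exact (h2 _).trans (congrArg _ (hf x))
      · refine ⟨.inl (e, f), ?_⟩
        rintro (x | x)
        · exact (h1 _).trans (congrArg _ (he x))
        · exact (h2 _).trans (congrArg _ (hf x))

theorem exists_rootedIso {s t : BinaryTree Unit} (e : TreeIso s t) :
    ∃ φ : RootedIso s t, ∀ x : Leaves s, φ.iso x.toVertex = (e.onLeaves x).toVertex := by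
  induction s generalizing t with
  | nil =>
    cases t with
    | nil => exact ⟨RootedIso.refl _, fun _ => rfl⟩
    | node b l r => exact e.elim
  | node a l r hl hr =>
    cases t with
    | nil => exact e.elim
    | node b l' r' =>
      rcases e with ⟨e, f⟩ | ⟨e, f⟩
      · obtain ⟨ψ, hψ⟩ := hl e
        obtain ⟨χ, hχ⟩ := hr f
        obtain ⟨φ, h1, h2⟩ := RootedIso.exists_node a b true ψ χ
        refine ⟨φ, ?_⟩
        rintro (x | x)
        · exact (h1 _).trans (congrArg Vertex.inLeft (hψ x))
        · exact (h2 _).trans (congrArg Vertex.inRight (hχ x))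
      · obtain ⟨ψ, hψ⟩ := hl e
        obtain ⟨χ, hχ⟩ := hr f
        obtain ⟨φ, h1, h2⟩ := RootedIso.exists_node a b false ψ χ
        refine ⟨φ, ?_⟩
        rintro (x | x)
        · exact (h1 _).trans (congrArg Vertex.inRight (hψ x))
        · exact (h2 _).trans (congrArg Vertex.inLeft (hχ x))

end TreeIso

/-- A bijection between the leaves of two plane binary trees is induced by an isomorphism of rooted
trees. -/
def IsTreeMap {s t : BinaryTree Unit} (e : Leaves s ≃ Leaves t) : Prop :=
  ∃ φ : RootedIso s t, ∀ x : Leaves s, φ.iso x.toVertex = (e x).toVertex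

namespace IsTreeMap

theorem symm {s t : BinaryTree Unit} {e : Leaves s ≃ Leaves t} (h : IsTreeMap e) :
    IsTreeMap e.symm := by
  obtain ⟨φ, hφ⟩ := h
  refine ⟨φ.symm, fun x => ?_⟩
  have := hφ (e.symm x)
  rw [Equiv.apply_symm_apply] at this
  rw [← this]
  exact φ.iso.symm_apply_apply _

theorem trans {s t u : BinaryTree Unit} {e : Leaves s ≃ Leaves t} {f : Leaves t ≃ Leaves u}
    (h : IsTreeMap e) (h' : IsTreeMap f) : IsTreeMap (e.trans f) := by
  obtain ⟨φ, hφ⟩ := h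
  obtain ⟨ψ, hψ⟩ := h'
  refine ⟨φ.trans ψ, fun x => ?_⟩
  change ψ.iso (φ.iso _) = _
  rw [hφ, hψ]
  rfl

end IsTreeMap

/-- The two descriptions serve different ends: `IsTreeMap` is plainly closed under composition and
inverse, while `TreeIso` can be counted by recursion. -/
theorem isTreeMap_iff {s t : BinaryTree Unit} (e : Leaves s ≃ Leaves t) :
    IsTreeMap e ↔ ∃ f : TreeIso s t, f.onLeaves = e := by
  constructor
  · rintro ⟨φ, hφ⟩
    obtain ⟨f, hf⟩ := TreeIso.exists_of_rootedIso φ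
    refine ⟨f, Equiv.ext fun x => Leaves.toVertex_injective ?_⟩
    rw [← hf, hφ]
  · rintro ⟨f, rfl⟩
    exact f.exists_rootedIso

/-- Isomorphisms of plane binary trees are the bijections of leaves induced by isomorphisms of
rooted trees. -/
noncomputable def treeIsoEquiv (s t : BinaryTree Unit) :
    TreeIso s t ≃ {e : Leaves s ≃ Leaves t // IsTreeMap e} :=
  Equiv.ofBijective (fun f => ⟨f.onLeaves, (isTreeMap_iff _).2 ⟨f, rfl⟩⟩)
    ⟨fun _ _ h => TreeIso.onLeaves_injective (congrArg Subtype.val h), fun e => by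
      obtain ⟨f, hf⟩ := (isTreeMap_iff e.1).1 e.2
      exact ⟨f, Subtype.ext hf⟩⟩

namespace TreeIso

theorem numLeaves_eq {s t : BinaryTree Unit} (e : TreeIso s t) : s.numLeaves = t.numLeaves := by
  rw [← Leaves.card, ← Leaves.card]
  exact Fintype.card_congr e.onLeaves

/-- The isomorphisms out of a node: isomorphisms out of both branches and the choice of an order. -/
def sigmaNode (a : Unit) (l r : BinaryTree Unit) :
    (Σ t, TreeIso (.node a l r) t) ≃ ((Σ t, TreeIso l t) × (Σ t, TreeIso r t)) × Bool where
  toFun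
    | ⟨.node _ l' r', .inl e⟩ => ((⟨l', e.1⟩, ⟨r', e.2⟩), true)
    | ⟨.node _ l' r', .inr e⟩ => ((⟨r', e.1⟩, ⟨l', e.2⟩), false)
  invFun
    | ((⟨l', e⟩, ⟨r', f⟩), true) => ⟨.node a l' r', .inl (e, f)⟩
    | ((⟨l', e⟩, ⟨r', f⟩), false) => ⟨.node a r' l', .inr (e, f)⟩
  left_inv := by
    rintro ⟨_ | ⟨_, l', r'⟩, e⟩
    · exact e.elim
    · rcases e with e | e <;> rfl
  right_inv := by
    rintro ⟨⟨⟨l', e⟩, ⟨r', f⟩⟩, _ | _⟩ <;> rfl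

/-- An isomorphism with free target amounts to one binary choice per internal vertex of the source;
these choices determine the target. -/
theorem finite_sigma_and_card (s : BinaryTree Unit) :
    Finite (Σ t, TreeIso s t) ∧ Nat.card (Σ t, TreeIso s t) = 2 ^ s.numNodes := by
  induction s with
  | nil =>
    have : Unique (Σ t, TreeIso .nil t) :=
      { default := ⟨.nil, ()⟩
        uniq := by
          rintro ⟨_ | ⟨_, l', r'⟩, e⟩
          · rfl
          · exact e.elim }
    exact ⟨inferInstance, by simp⟩
  | node a l r hl hr =>
    have := hl.1
    have := hr.1
    refine ⟨Finite.of_equiv _ (sigmaNode a l r).symm, ?_⟩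
    rw [Nat.card_congr (sigmaNode a l r), Nat.card_prod, Nat.card_prod, hl.2, hr.2]
    simp [BinaryTree.numNodes, pow_add]

end TreeIso

/-! ### Counting tanglegrams by a groupoid of matched pairs. -/

/-- Counting the classes of a finite groupoid in which every object has the same number `K` of
outgoing arrows. -/
theorem mul_card_classes {X Q : Type*} [Fintype X] (π : X → Q) (hπ : Function.Surjective π)
    (H : X → X → Type*) [∀ x y, Finite (H x y)] (K : ℕ) (hK : ∀ x, ∑ y, Nat.card (H x y) = K)
    (h1 : ∀ x y, π x = π y → Nat.card (H x y) = Nat.card (H y y))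
    (h0 : ∀ x y, π x ≠ π y → IsEmpty (H x y)) (P : Q → Prop) [DecidablePred P] :
    K * Nat.card {c : Q // P c} = ∑ x with P (π x), Nat.card (H x x) := by
  classical
  have : Fintype Q := Fintype.ofSurjective π hπ
  -- For `y` in the class, an object `x` of the same class receives as many arrows from `y` as it
  -- has automorphisms, and all arrows out of `y` end in the class.
  have key : ∀ c : Q, ∑ x with π x = c, Nat.card (H x x) = K := by
    intro c
    obtain ⟨y, rfl⟩ := hπ c
    rw [← hK y, ← Finset.sum_filter_add_sum_filter_not Finset.univ (fun x => π x = π y)]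
    rw [Finset.sum_eq_zero (s := Finset.univ.filter fun x => ¬ π x = π y), add_zero]
    · exact Finset.sum_congr rfl fun x hx => (h1 y x (Finset.mem_filter.1 hx).2.symm).symm
    · intro x hx
      have := h0 y x (Ne.symm (Finset.mem_filter.1 hx).2)
      exact Nat.card_of_isEmpty
  rw [Nat.card_eq_fintype_card, Fintype.card_subtype, mul_comm, ← smul_eq_mul, ← Finset.sum_const]
  rw [← Finset.sum_fiberwise_of_maps_to (s := Finset.univ.filter fun x => P (π x))
    (t := Finset.univ.filter P) (g := π) (by simp)]
  refine Finset.sum_congr rfl fun c hc => ?_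
  rw [← key c]
  refine Finset.sum_congr ?_ fun _ _ => rfl
  ext x
  simp only [Finset.mem_filter, Finset.mem_univ, true_and] at hc ⊢
  exact ⟨fun h => ⟨h ▸ hc, h⟩, fun h => h.2⟩

theorem PlaneTree.numNodes_eq {n : ℕ} (t : PlaneTree n) : t.tree.numNodes = n - 1 := by
  have := t.numLeaves_eq
  rw [BinaryTree.numLeaves_eq_numNodes_succ] at this
  omega

/-- Plane trees with `n + 1` leaves are plane trees with `n` internal vertices. -/
def planeTreeEquiv (n : ℕ) : PlaneTree (n + 1) ≃ BinaryTree.treesOfNumNodesEq n where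
  toFun t := ⟨t.tree, BinaryTree.mem_treesOfNumNodesEq.2 t.numNodes_eq⟩
  invFun t := ⟨t.1, by
    rw [BinaryTree.numLeaves_eq_numNodes_succ, BinaryTree.mem_treesOfNumNodesEq.1 t.2]⟩
  left_inv _ := rfl
  right_inv _ := rfl

noncomputable instance PlaneTree.instFintype (n : ℕ) : Fintype (PlaneTree n) :=
  Fintype.ofInjective
    (fun t => (⟨t.tree, BinaryTree.mem_treesOfNumNodesEq.2 t.numNodes_eq⟩ :
      BinaryTree.treesOfNumNodesEq (n - 1)))
    (by
      rintro ⟨s, hs⟩ ⟨t, ht⟩ h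
      obtain rfl : s = t := congrArg Subtype.val h
      rfl)

theorem sum_planeTree {M : Type*} [AddCommMonoid M] (n : ℕ) (f : BinaryTree Unit → M) :
    ∑ t : PlaneTree (n + 1), f t.tree = ∑ t ∈ BinaryTree.treesOfNumNodesEq n, f t := by
  rw [← Finset.sum_coe_sort (BinaryTree.treesOfNumNodesEq n)]
  exact Fintype.sum_equiv (planeTreeEquiv n) _ _ fun _ => rfl

theorem card_planeTree (n : ℕ) : Fintype.card (PlaneTree (n + 1)) = catalan n := by
  rw [Fintype.card_congr (planeTreeEquiv n), Fintype.card_coe,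
    BinaryTree.treesOfNumNodesEq_card_eq_catalan]

instance PlaneTree.instNonempty (n : ℕ) : Nonempty (PlaneTree (n + 1)) := by
  rw [← Fintype.card_pos_iff, card_planeTree]
  have := succ_mul_catalan_eq_centralBinom n
  have h := n.centralBinom_pos
  rw [← this] at h
  exact Nat.pos_of_mul_pos_left h

theorem sum_card_treeIso {n : ℕ} (s : PlaneTree (n + 1)) :
    ∑ t : PlaneTree (n + 1), Nat.card (TreeIso s.tree t.tree) = 2 ^ n := by
  have hn := s.numNodes_eq
  rw [Nat.add_sub_cancel] at hn
  have h : 2 ^ n = 2 ^ s.tree.numNodes := by rw [hn]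
  rw [h, ← (TreeIso.finite_sigma_and_card s.tree).2, ← Nat.card_sigma]
  refine Nat.card_congr ⟨fun p => ⟨p.1.tree, p.2⟩, fun p => ⟨⟨p.1, ?_⟩, p.2⟩, ?_, ?_⟩
  · rw [← p.2.numLeaves_eq, s.numLeaves_eq]
  · exact fun _ => rfl
  · exact fun _ => rfl

/-- Pairs of plane trees with a matching of their leaves. -/
abbrev LeafMatching (n : ℕ) : Type :=
  Σ p : PlaneTree n × PlaneTree n, Leaves p.1.tree ≃ Leaves p.2.tree

/-- Arrows between matched pairs of plane trees. -/
abbrev LeafMatching.Hom {n : ℕ} (x y : LeafMatching n) : Type :=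
  {p : (Leaves x.1.1.tree ≃ Leaves y.1.1.tree) × (Leaves x.1.2.tree ≃ Leaves y.1.2.tree) //
    (IsTreeMap p.1 ∧ IsTreeMap p.2) ∧ x.2.trans p.2 = p.1.trans y.2}

/-- The representation of a tanglegram given by a matched pair of plane trees. -/
noncomputable def LeafMatching.toRep {n : ℕ} (x : LeafMatching n) : TangleRep n :=
  ⟨x.1.1, x.1.2, (leafEquiv _).symm.trans (x.2.trans (leafEquiv _))⟩

theorem LeafMatching.toRep_surjective {n : ℕ} :
    Function.Surjective (LeafMatching.toRep : LeafMatching n → TangleRep n) := by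
  rintro ⟨s, t, m⟩
  refine ⟨⟨(s, t), (leafEquiv _).trans (m.trans (leafEquiv _).symm)⟩, ?_⟩
  simp only [toRep, TangleRep.mk.injEq, heq_eq_eq, true_and]
  ext x
  simp

theorem LeafMatching.matched_iff {n : ℕ} (x : LeafMatching n) (v : Vertex x.1.1.tree)
    (w : Vertex x.1.2.tree) :
    x.toRep.Matched v w ↔ ∃ a, a.toVertex = v ∧ (x.2 a).toVertex = w := by
  constructor
  · rintro ⟨a, rfl, rfl⟩
    refine ⟨(leafEquiv _).symm a, ?_, ?_⟩
    · exact congrArg Subtype.val ((leafEquiv _).apply_symm_apply a)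
    · rfl
  · rintro ⟨a, rfl, rfl⟩
    refine ⟨leafEquiv _ a, leafEquiv_coe a, ?_⟩
    change (leafEquiv _ (x.2 ((leafEquiv _).symm (leafEquiv _ a)))).1 = _
    rw [Equiv.symm_apply_apply]
    rfl

/-- The tanglegram given by a matched pair of plane trees. -/
noncomputable def LeafMatching.toTanglegram {n : ℕ} (x : LeafMatching n) : Tanglegram n :=
  Quotient.mk (tangleSetoid n) x.toRep

theorem LeafMatching.toTanglegram_surjective {n : ℕ} :
    Function.Surjective (LeafMatching.toTanglegram : LeafMatching n → Tanglegram n) :=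
  (Quotient.mk_surjective (s := tangleSetoid n)).comp toRep_surjective

theorem LeafMatching.toTanglegram_eq_iff {n : ℕ} (x y : LeafMatching n) :
    x.toTanglegram = y.toTanglegram ↔ Nonempty (x.Hom y) := by
  refine (Quotient.eq (r := tangleSetoid n)).trans ?_
  constructor
  · rintro ⟨φ, ψ, h⟩
    obtain ⟨e, he⟩ := TreeIso.exists_of_rootedIso φ
    obtain ⟨f, hf⟩ := TreeIso.exists_of_rootedIso ψ
    refine ⟨⟨(e.onLeaves, f.onLeaves), ⟨⟨φ, he⟩, ⟨ψ, hf⟩⟩, Equiv.ext fun a => ?_⟩⟩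
    have := (h _ _).1 ((x.matched_iff _ _).2 ⟨a, rfl, rfl⟩)
    obtain ⟨b, hb, hb'⟩ := (y.matched_iff _ _).1 this
    rw [show φ.iso a.toVertex = _ from he a] at hb
    rw [show ψ.iso (x.2 a).toVertex = _ from hf (x.2 a)] at hb'
    rw [Leaves.toVertex_injective hb] at hb'
    exact (Leaves.toVertex_injective hb').symm
  · rintro ⟨⟨⟨e, f⟩, ⟨⟨φ, he⟩, ⟨ψ, hf⟩⟩, h⟩⟩
    have h' : ∀ a, f (x.2 a) = y.2 (e a) := fun a => Equiv.congr_fun h a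
    refine ⟨φ, ψ, fun v w => ?_⟩
    refine (x.matched_iff v w).trans (Iff.trans ?_ (y.matched_iff _ _).symm)
    constructor
    · rintro ⟨a, rfl, rfl⟩
      refine ⟨e a, (he a).symm, ?_⟩
      rw [← h']
      exact (hf _).symm
    · rintro ⟨b, hb, hb'⟩
      obtain ⟨a, rfl⟩ := e.surjective b
      refine ⟨a, φ.iso.injective ((he a).trans hb), ψ.iso.injective ?_⟩
      rw [← h'] at hb'
      exact (hf _).trans hb'

/-- Composition with one fixed arrow from `x` to `y` identifies the two sets of arrows. -/
theorem LeafMatching.card_hom_of_eq {n : ℕ} (x y : LeafMatching n)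
    (h : x.toTanglegram = y.toTanglegram) : Nat.card (x.Hom y) = Nat.card (y.Hom y) := by
  obtain ⟨⟨⟨e, f⟩, ⟨he, hf⟩, hc⟩⟩ := (toTanglegram_eq_iff x y).1 h
  have hc' : ∀ a, f (x.2 a) = y.2 (e a) := fun a => Equiv.congr_fun hc a
  refine Nat.card_congr ⟨fun p => ⟨(e.symm.trans p.1.1, f.symm.trans p.1.2),
    ⟨he.symm.trans p.2.1.1, hf.symm.trans p.2.1.2⟩, ?_⟩, fun p => ⟨(e.trans p.1.1, f.trans p.1.2),
    ⟨he.trans p.2.1.1, hf.trans p.2.1.2⟩, ?_⟩, fun p => ?_, fun p => ?_⟩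
  · ext b
    obtain ⟨a, rfl⟩ := e.surjective b
    have := Equiv.congr_fun p.2.2 a
    simp only [Equiv.trans_apply] at this ⊢
    rw [← hc', Equiv.symm_apply_apply, Equiv.symm_apply_apply, this]
  · ext a
    have := Equiv.congr_fun p.2.2 (e a)
    simp only [Equiv.trans_apply] at this ⊢
    rw [hc', this]
  · refine Subtype.ext (Prod.ext ?_ ?_) <;> ext <;> simp
  · refine Subtype.ext (Prod.ext ?_ ?_) <;> ext <;> simp

/-- Two tree isomorphisms carry the matching of `x` to exactly one matching of their targets, so the
number of outgoing arrows is the product `2 ^ n * 2 ^ n`. -/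
theorem LeafMatching.sum_card_hom {n : ℕ} (x : LeafMatching (n + 1)) :
    ∑ y, Nat.card (x.Hom y) = 4 ^ n := by
  have key : ∀ s t : PlaneTree (n + 1), ∑ m : Leaves s.tree ≃ Leaves t.tree,
      Nat.card (x.Hom ⟨(s, t), m⟩) =
        Nat.card (TreeIso x.1.1.tree s.tree) * Nat.card (TreeIso x.1.2.tree t.tree) := by
    intro s t
    rw [← Nat.card_sigma, Nat.card_congr (treeIsoEquiv _ _), Nat.card_congr (treeIsoEquiv _ _),
      ← Nat.card_prod]
    refine Nat.card_congr ⟨fun p => (⟨p.2.1.1, p.2.2.1.1⟩, ⟨p.2.1.2, p.2.2.1.2⟩),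
      fun p => ⟨p.1.1.symm.trans (x.2.trans p.2.1), ⟨(p.1.1, p.2.1), ⟨p.1.2, p.2.2⟩, ?_⟩⟩, ?_, ?_⟩
    · ext
      simp
    · rintro ⟨m, ⟨⟨(e : Leaves x.1.1.tree ≃ Leaves s.tree),
        (f : Leaves x.1.2.tree ≃ Leaves t.tree)⟩, ⟨he, hf⟩, h⟩⟩
      have h : x.2.trans f = e.trans m := h
      obtain rfl : m = e.symm.trans (x.2.trans f) := by
        rw [h]
        ext
        simp
      rfl
    · exact fun _ => rfl
  rw [Fintype.sum_sigma, Fintype.sum_prod_type]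
  simp_rw [key]
  rw [← Finset.sum_mul_sum, sum_card_treeIso, sum_card_treeIso, ← mul_pow]
  norm_num

/-- The number of triples of an automorphism of `s`, an automorphism of `t`, and a bijection of
leaves that intertwines the two. -/
noncomputable def intertwineCount (s t : BinaryTree Unit) : ℕ :=
  ∑ a : TreeIso s s, ∑ b : TreeIso t t,
    Nat.card {σ : Leaves s ≃ Leaves t // σ.trans b.onLeaves = a.onLeaves.trans σ}

/-- An automorphism of a matched pair is a pair of tree automorphisms intertwined by the matching;
the two sides count the same triples in different orders. -/
theorem LeafMatching.sum_card_aut {n : ℕ} (s t : PlaneTree n) :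
    ∑ m : Leaves s.tree ≃ Leaves t.tree,
      Nat.card (LeafMatching.Hom ⟨(s, t), m⟩ ⟨(s, t), m⟩) = intertwineCount s.tree t.tree := by
  rw [intertwineCount, ← Nat.card_sigma]
  simp_rw [← Nat.card_sigma]
  refine Nat.card_congr (Equiv.symm ?_)
  refine ⟨fun p => ⟨p.2.2.1, ⟨((treeIsoEquiv _ _ p.1).1, (treeIsoEquiv _ _ p.2.1).1),
    ⟨(treeIsoEquiv _ _ p.1).2, (treeIsoEquiv _ _ p.2.1).2⟩, p.2.2.2⟩⟩,
    fun p => ⟨(treeIsoEquiv _ _).symm ⟨p.2.1.1, p.2.2.1.1⟩,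
      (treeIsoEquiv _ _).symm ⟨p.2.1.2, p.2.2.1.2⟩, ⟨p.1, ?_⟩⟩, ?_, ?_⟩
  · have h1 : ((treeIsoEquiv _ _).symm ⟨p.2.1.1, p.2.2.1.1⟩).onLeaves = p.2.1.1 :=
      congrArg Subtype.val ((treeIsoEquiv _ _).apply_symm_apply ⟨p.2.1.1, p.2.2.1.1⟩)
    have h2 : ((treeIsoEquiv _ _).symm ⟨p.2.1.2, p.2.2.1.2⟩).onLeaves = p.2.1.2 :=
      congrArg Subtype.val ((treeIsoEquiv _ _).apply_symm_apply ⟨p.2.1.2, p.2.2.1.2⟩)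
    rw [h1, h2]
    exact p.2.2.2
  · rintro ⟨a, b, σ, h⟩
    have h1 : (treeIsoEquiv _ _).symm ⟨(treeIsoEquiv _ _ a).1, (treeIsoEquiv _ _ a).2⟩ = a :=
      (treeIsoEquiv _ _).symm_apply_apply a
    have h2 : (treeIsoEquiv _ _).symm ⟨(treeIsoEquiv _ _ b).1, (treeIsoEquiv _ _ b).2⟩ = b :=
      (treeIsoEquiv _ _).symm_apply_apply b
    have ext : ∀ (a' : TreeIso s.tree s.tree) (b' : TreeIso t.tree t.tree) (h' : _), a' = a →
        b' = b → (⟨a', b', ⟨σ, h'⟩⟩ : Σ a : TreeIso s.tree s.tree, Σ b : TreeIso t.tree t.tree,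
          {σ : Leaves s.tree ≃ Leaves t.tree // σ.trans b.onLeaves = a.onLeaves.trans σ}) =
          ⟨a, b, ⟨σ, h⟩⟩ := by
      rintro a' b' h' rfl rfl
      rfl
    exact ext _ _ _ h1 h2
  · rintro ⟨m, ⟨⟨e, f⟩, ⟨he, hf⟩, h⟩⟩
    simp

theorem card_tanglegram {n : ℕ} (S : Set (BinTree (n + 1) × BinTree (n + 1)))
    [DecidablePred (· ∈ S)] :
    4 ^ n * Nat.card {T : Tanglegram (n + 1) // T.halves ∈ S} =
      ∑ p : PlaneTree (n + 1) × PlaneTree (n + 1) with (p.1.toBinTree, p.2.toBinTree) ∈ S,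
        intertwineCount p.1.tree p.2.tree := by
  classical
  rw [mul_card_classes LeafMatching.toTanglegram LeafMatching.toTanglegram_surjective
    LeafMatching.Hom (4 ^ n) LeafMatching.sum_card_hom LeafMatching.card_hom_of_eq
    (fun x y h => not_nonempty_iff.1 fun h' => h ((LeafMatching.toTanglegram_eq_iff x y).2 h'))]
  rw [Finset.sum_filter, Fintype.sum_sigma, Finset.sum_filter]
  refine Finset.sum_congr rfl fun p _ => ?_
  have : ∀ m, (LeafMatching.toTanglegram ⟨p, m⟩).halves = (p.1.toBinTree, p.2.toBinTree) :=
    fun m => rfl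
  simp_rw [this]
  split_ifs
  · exact LeafMatching.sum_card_aut p.1 p.2
  · simp

instance (n : ℕ) : Finite (Tanglegram n) :=
  Finite.of_surjective _ LeafMatching.toTanglegram_surjective

instance (n : ℕ) : Finite (BinTree n) :=
  Finite.of_surjective _ (Quotient.mk_surjective (s := planeTreeSetoid n))

instance (n : ℕ) : DiscreteMeasurableSpace (PlaneTree n) := ⟨fun _ => trivial⟩

instance (n : ℕ) : DiscreteMeasurableSpace (BinTree n) := ⟨fun _ => trivial⟩

instance (n : ℕ) : DiscreteMeasurableSpace (Tanglegram n) := ⟨fun _ => trivial⟩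

theorem uniformOn_univ_real {Ω : Type*} [MeasurableSpace Ω] [DiscreteMeasurableSpace Ω] [Finite Ω]
    (s : Set Ω) : (uniformOn (Set.univ : Set Ω)).real s = Nat.card s / Nat.card Ω := by
  have := Fintype.ofFinite Ω
  have h : s.encard = (Nat.card s : ℕ) := by
    rw [Nat.card_coe_set_eq, s.toFinite.cast_ncard_eq]
  rw [measureReal_def, uniformOn_univ, Measure.count_apply s.toFinite.measurableSet,
    ENNReal.toReal_div, ENNReal.toReal_natCast, h, Nat.card_eq_fintype_card (α := Ω)]
  rfl

/-- The factor `4 ^ n` of `card_tanglegram` is independent of `S` and cancels from the ratio. What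
is left is the uniform measure on pairs of plane trees reweighted by `intertwineCount`. -/
theorem nuT_real {n : ℕ} (S : Set (BinTree (n + 1) × BinTree (n + 1))) [DecidablePred (· ∈ S)] :
    (nuT (n + 1)).real S =
      (∑ p : PlaneTree (n + 1) × PlaneTree (n + 1) with (p.1.toBinTree, p.2.toBinTree) ∈ S,
        (intertwineCount p.1.tree p.2.tree : ℝ)) /
      ∑ p : PlaneTree (n + 1) × PlaneTree (n + 1), (intertwineCount p.1.tree p.2.tree : ℝ) := by
  classical
  rw [nuT, map_measureReal_apply (Measurable.of_discrete) (MeasurableSet.of_discrete),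
    uniformOn_univ_real]
  have h1 := card_tanglegram S
  have h2 := card_tanglegram (n := n) Set.univ
  have h3 : Nat.card {T : Tanglegram (n + 1) // T.halves ∈ Set.univ} =
      Nat.card (Tanglegram (n + 1)) :=
    Nat.card_congr (Equiv.subtypeUnivEquiv fun _ => trivial)
  rw [h3] at h2
  simp only [Set.mem_univ, Finset.filter_true] at h2
  rw [← Nat.cast_sum, ← Nat.cast_sum, ← h1, ← h2]
  push_cast
  rw [mul_div_mul_left _ _ (by positivity)]
  rfl

theorem nuP_real {n : ℕ} (S : Set (BinTree (n + 1) × BinTree (n + 1))) [DecidablePred (· ∈ S)] :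
    (nuP (n + 1)).real S =
      (∑ p : PlaneTree (n + 1) × PlaneTree (n + 1) with (p.1.toBinTree, p.2.toBinTree) ∈ S,
        (1 : ℝ)) / Fintype.card (PlaneTree (n + 1) × PlaneTree (n + 1)) := by
  classical
  rw [nuP, map_measureReal_apply (Measurable.of_discrete) (MeasurableSet.of_discrete)]
  have h : (fun p : PlaneTree (n + 1) × PlaneTree (n + 1) => (p.1.toBinTree, p.2.toBinTree)) ⁻¹' S =
      ↑(Finset.univ.filter fun p : PlaneTree (n + 1) × PlaneTree (n + 1) =>
        (p.1.toBinTree, p.2.toBinTree) ∈ S) := by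
    ext p
    simp
  rw [h, ← sum_measureReal_singleton, Finset.sum_div]
  refine Finset.sum_congr rfl fun p _ => ?_
  rw [← Set.singleton_prod_singleton, measureReal_prod_prod, uniformOn_univ_real,
    uniformOn_univ_real, Fintype.card_prod]
  simp only [Nat.card_eq_fintype_card, Fintype.card_unique]
  push_cast
  rw [div_mul_div_comm, one_mul]

/-! ### Centralizers of permutations and intertwining bijections. -/

open scoped Nat

theorem doubleFactorial_monotone : Monotone Nat.doubleFactorial := by
  refine monotone_nat_of_le_succ fun n => ?_
  induction n using Nat.twoStepInduction with
  | zero => rfl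
  | one => decide
  | more n ih _ =>
    rw [Nat.doubleFactorial_add_two, Nat.doubleFactorial_add_two]
    exact Nat.mul_le_mul (by omega) ih

/-- For `M` a cycle type, the left side is the contribution of the nontrivial cycles to the order of
the centralizer. Adding a part `p` multiplies it by `p * (count p + 1) ≤ sum + p`, and since `p ≥ 2`
the double factorial grows by at least the factor `sum + p`. The finite set `F` keeps the range of
the product fixed during the induction. -/
theorem Multiset.prod_mul_prod_factorial_count_le (F : Finset ℕ) (M : Multiset ℕ)
    (h : ∀ x ∈ M, 2 ≤ x ∧ x ∈ F) : M.prod * ∏ n ∈ F, (M.count n)! ≤ M.sum‼ := by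
  induction M using Multiset.induction_on with
  | empty => simp
  | cons p M ih =>
    have hp := h p (Multiset.mem_cons_self p M)
    have ih := ih fun x hx => h x (Multiset.mem_cons_of_mem hx)
    have h1 : ∏ n ∈ F, ((p ::ₘ M).count n)! = (M.count p + 1) * ∏ n ∈ F, (M.count n)! := by
      have : ∀ n ∈ F, ((p ::ₘ M).count n)! =
          (if n = p then M.count p + 1 else 1) * (M.count n)! := by
        intro n _
        rw [Multiset.count_cons]
        split_ifs with hn
        · rw [hn, Nat.factorial_succ]
        · simp
      rw [Finset.prod_congr rfl this, Finset.prod_mul_distrib, Finset.prod_ite_eq' F p,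
        if_pos hp.2]
    have h2 : p * M.count p ≤ M.sum := by
      obtain ⟨u, hu⟩ := Multiset.le_iff_exists_add.1
        (Multiset.le_count_iff_replicate_le.1 (le_refl (M.count p)))
      have := congrArg Multiset.sum hu
      rw [Multiset.sum_add, Multiset.sum_replicate, smul_eq_mul, mul_comm] at this
      omega
    rw [h1, Multiset.prod_cons, Multiset.sum_cons]
    obtain ⟨q, rfl⟩ : ∃ q, p = q + 2 := ⟨p - 2, by omega⟩
    calc (q + 2) * M.prod * ((M.count (q + 2) + 1) * ∏ n ∈ F, (M.count n)!)
        = ((q + 2) * M.count (q + 2) + (q + 2)) * (M.prod * ∏ n ∈ F, (M.count n)!) := by ring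
      _ ≤ (M.sum + (q + 2)) * M.sum‼ := Nat.mul_le_mul (by omega) ih
      _ ≤ (q + M.sum + 2) * (q + M.sum)‼ :=
        Nat.mul_le_mul (by omega) (doubleFactorial_monotone (by omega))
      _ = (q + 2 + M.sum)‼ := by
        rw [← Nat.doubleFactorial_add_two]
        congr 1
        omega

/-- The number of fixed points of a permutation. -/
def fixCount {α : Type*} [Fintype α] [DecidableEq α] (a : α ≃ α) : ℕ :=
  (Finset.univ.filter fun x => a x = x).card

section Centralizer

variable {α β : Type*} [Fintype α] [DecidableEq α] [Fintype β] [DecidableEq β]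

theorem fixCount_add_sum_cycleType (g : Equiv.Perm α) :
    fixCount g + g.cycleType.sum = Fintype.card α := by
  rw [Equiv.Perm.sum_cycleType, fixCount, ← Finset.card_univ,
    ← Finset.card_filter_add_card_filter_not (s := Finset.univ) (fun x => g x = x)]
  congr 2

theorem fixCount_le_card (g : α ≃ α) : fixCount g ≤ Fintype.card α :=
  (Nat.le_add_right _ _).trans_eq (fixCount_add_sum_cycleType g)

theorem card_centralizer_le (g : Equiv.Perm α) :
    Nat.card (Subgroup.centralizer {g}) ≤
      (fixCount g)! * (Fintype.card α - fixCount g)‼ := by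
  have h := fixCount_add_sum_cycleType g
  rw [Equiv.Perm.nat_card_centralizer, mul_assoc, ← h, Nat.add_sub_cancel, Nat.add_sub_cancel_left]
  refine Nat.mul_le_mul_left _ (Multiset.prod_mul_prod_factorial_count_le _ _ fun x hx => ?_)
  exact ⟨Equiv.Perm.two_le_of_mem_cycleType hx, Multiset.mem_toFinset.2 hx⟩

theorem cycleType_of_involutive (g : Equiv.Perm α) (hg : ∀ x, g (g x) = x) :
    g.cycleType = Multiset.replicate (Multiset.card g.cycleType) 2 := by
  rw [Multiset.eq_replicate_card]
  exact Equiv.Perm.pow_prime_eq_one_iff.1 (Equiv.ext fun x => by simp [pow_two, hg])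

/-- With `k` two-cycles and no longer ones, the nontrivial cycles contribute `2 ^ k * k! = (2k)‼`,
so the general upper bound is attained. -/
theorem card_centralizer_of_involutive (g : Equiv.Perm α) (hg : ∀ x, g (g x) = x) :
    Nat.card (Subgroup.centralizer {g}) =
      (fixCount g)! * (Fintype.card α - fixCount g)‼ := by
  have h := fixCount_add_sum_cycleType g
  rw [Equiv.Perm.nat_card_centralizer, mul_assoc, ← h, Nat.add_sub_cancel, Nat.add_sub_cancel_left]
  congr 1
  rw [cycleType_of_involutive g hg]
  generalize Multiset.card g.cycleType = k
  rw [Multiset.prod_replicate, Multiset.sum_replicate, smul_eq_mul, mul_comm k 2,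
    Nat.doubleFactorial_two_mul]
  rcases k.eq_zero_or_pos with rfl | hk
  · simp
  · rw [Multiset.toFinset_replicate, if_neg hk.ne', Finset.prod_singleton,
      Multiset.count_replicate_self]

omit [Fintype α] [DecidableEq α] [Fintype β] [DecidableEq β] in
-- Once nonempty, the set of intertwining bijections is a torsor under the centralizer of `a`.
theorem card_intertwine_eq_card_centralizer (a : Equiv.Perm α) (b : Equiv.Perm β) (σ₀ : α ≃ β)
    (h : ∀ x, b (σ₀ x) = σ₀ (a x)) :
    Nat.card {σ : α ≃ β // σ.trans b = a.trans σ} = Nat.card (Subgroup.centralizer {a}) := by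
  have h' : ∀ y, σ₀.symm (b y) = a (σ₀.symm y) := fun y => by
    rw [Equiv.symm_apply_eq, ← h, Equiv.apply_symm_apply]
  refine Nat.card_congr ⟨fun σ => ⟨σ.1.trans σ₀.symm, ?_⟩, fun τ => ⟨τ.1.trans σ₀, ?_⟩, ?_, ?_⟩
  · rw [Subgroup.mem_centralizer_singleton_iff]
    ext x
    have := Equiv.congr_fun σ.2 x
    simp only [Equiv.trans_apply] at this
    simp only [Equiv.Perm.mul_apply, Equiv.trans_apply]
    rw [← this, h']
  · have := Subgroup.mem_centralizer_singleton_iff.1 τ.2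
    ext x
    have := Equiv.congr_fun this x
    simp only [Equiv.Perm.mul_apply] at this
    simp only [Equiv.trans_apply]
    rw [h, this]
  · intro σ
    ext
    simp
  · intro τ
    ext
    simp

theorem fixCount_eq_of_intertwine (a : α ≃ α) (b : β ≃ β) (σ : α ≃ β)
    (h : ∀ x, b (σ x) = σ (a x)) : fixCount a = fixCount b := by
  refine Finset.card_equiv σ fun x => ?_
  simp [h]

theorem card_intertwine_le (a : α ≃ α) (b : β ≃ β) :
    Nat.card {σ : α ≃ β // σ.trans b = a.trans σ} ≤
      if fixCount a = fixCount b then (fixCount a)! * (Fintype.card α - fixCount a)‼ else 0 := by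
  rcases isEmpty_or_nonempty {σ : α ≃ β // σ.trans b = a.trans σ} with he | ⟨⟨σ, hσ⟩⟩
  · rw [Nat.card_of_isEmpty]
    exact Nat.zero_le _
  · have h : ∀ x, b (σ x) = σ (a x) := Equiv.congr_fun hσ
    rw [if_pos (fixCount_eq_of_intertwine a b σ h), card_intertwine_eq_card_centralizer a b σ h]
    exact card_centralizer_le a

/-- Involutions of sets of equal size are conjugate as soon as they have equally many fixed points,
so here an intertwining bijection exists whenever the obvious condition holds. -/
theorem card_intertwine_of_involutive (a : α ≃ α) (b : β ≃ β) (ha : ∀ x, a (a x) = x)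
    (hb : ∀ x, b (b x) = x) (hαβ : Fintype.card α = Fintype.card β) :
    Nat.card {σ : α ≃ β // σ.trans b = a.trans σ} =
      if fixCount a = fixCount b then (fixCount a)! * (Fintype.card α - fixCount a)‼ else 0 := by
  split_ifs with h
  · obtain ⟨e⟩ := Fintype.card_eq.1 hαβ
    let c : Equiv.Perm α := (e.trans b).trans e.symm
    have hec : ∀ x, b (e x) = e (c x) := fun x => by simp [c]
    have hc : ∀ x, c (c x) = x := fun x => by simp [c, hb]
    have hfix : fixCount c = fixCount a := (fixCount_eq_of_intertwine c b e hec).trans h.symm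
    have hconj : IsConj a c := by
      rw [Equiv.Perm.isConj_iff_cycleType_eq, cycleType_of_involutive a ha,
        cycleType_of_involutive c hc]
      congr 1
      have h1 := fixCount_add_sum_cycleType a
      have h2 := fixCount_add_sum_cycleType c
      rw [cycleType_of_involutive a ha, Multiset.sum_replicate, smul_eq_mul] at h1
      rw [cycleType_of_involutive c hc, Multiset.sum_replicate, smul_eq_mul] at h2
      omega
    obtain ⟨τ, hτ⟩ := isConj_iff.1 hconj
    have hτ' : ∀ x, c (τ x) = τ (a x) := fun x => by
      rw [← hτ]
      simp
    rw [card_intertwine_eq_card_centralizer a b (τ.trans e) fun x => by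
      rw [Equiv.trans_apply, Equiv.trans_apply, hec, hτ'], card_centralizer_of_involutive a ha]
  · rw [Nat.card_eq_zero]
    refine .inl ⟨fun σ => h (fixCount_eq_of_intertwine a b σ.1 (Equiv.congr_fun σ.2))⟩

end Centralizer

/-! ### Bounds on the weight by automorphisms and by cherry swaps. -/

/-- The product of the swaps of some of the cherries of a tree. -/
def TreeIso.IsCherrySwap : ∀ {t : BinaryTree Unit}, TreeIso t t → Prop
  | .nil, _ => True
  | .node _ _ _, .inl e => IsCherrySwap e.1 ∧ IsCherrySwap e.2
  | .node _ l r, .inr _ => l = .nil ∧ r = .nil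

theorem TreeIso.IsCherrySwap.involutive {t : BinaryTree Unit} {e : TreeIso t t}
    (h : e.IsCherrySwap) (x : Leaves t) : e.onLeaves (e.onLeaves x) = x := by
  induction t with
  | nil => rfl
  | node a l r hl hr =>
    rcases e with e | e
    · rcases x with x | x
      · exact congrArg Sum.inl (hl h.1 x)
      · exact congrArg Sum.inr (hr h.2 x)
    · obtain ⟨rfl, rfl⟩ := h
      rcases x with x | x <;> rfl

open Classical in
/-- The number of automorphisms of a tree that fix `m` leaves. -/
noncomputable def autCount (t : BinaryTree Unit) (m : ℕ) : ℕ :=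
  (Finset.univ.filter fun e : TreeIso t t => fixCount e.onLeaves = m).card

open Classical in
/-- The number of products of cherry swaps of a tree that fix `m` leaves. -/
noncomputable def cherrySwapCount (t : BinaryTree Unit) (m : ℕ) : ℕ :=
  (Finset.univ.filter fun e : TreeIso t t => e.IsCherrySwap ∧ fixCount e.onLeaves = m).card

/-- Grouping by the common number `m` of fixed points decouples the two trees: for each `m` the sum
is a product of two counts. -/
theorem sum_ite_fixCount_eq {ι κ : Type*} (A : Finset ι) (B : Finset κ) (f : ι → ℕ) (g : κ → ℕ)
    (w : ℕ → ℕ) (n : ℕ) (hf : ∀ a ∈ A, f a ≤ n) :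
    ∑ a ∈ A, ∑ b ∈ B, (if f a = g b then w (f a) else 0) =
      ∑ m ∈ Finset.range (n + 1), w m * ((A.filter fun a => f a = m).card *
        (B.filter fun b => g b = m).card) := by
  have : ∀ m, w m * ((A.filter fun a => f a = m).card * (B.filter fun b => g b = m).card) =
      ∑ a ∈ A, if f a = m then ∑ b ∈ B, (if g b = m then w m else 0) else 0 := by
    intro m
    rw [← Finset.sum_filter, Finset.sum_const, ← Finset.sum_filter, Finset.sum_const, smul_eq_mul,
      smul_eq_mul]
    ring
  simp_rw [this]
  conv_rhs => rw [Finset.sum_comm]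
  refine Finset.sum_congr rfl fun a ha => ?_
  rw [Finset.sum_ite_eq, if_pos (Finset.mem_range.2 (Nat.lt_succ_of_le (hf a ha)))]
  exact Finset.sum_congr rfl fun b _ => by simp only [eq_comm]

theorem intertwineCount_le {s t : BinaryTree Unit} {n : ℕ} (hs : s.numLeaves = n) :
    intertwineCount s t ≤
      ∑ m ∈ Finset.range (n + 1), m ! * (n - m)‼ * (autCount s m * autCount t m) := by
  classical
  have h := sum_ite_fixCount_eq (Finset.univ : Finset (TreeIso s s))
    (Finset.univ : Finset (TreeIso t t)) (fun e => fixCount e.onLeaves)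
    (fun e => fixCount e.onLeaves) (fun m => m ! * (n - m)‼) n
    (fun e _ => (fixCount_le_card _).trans_eq ((Leaves.card s).trans hs))
  have h' : intertwineCount s t ≤ ∑ a : TreeIso s s, ∑ b : TreeIso t t,
      if fixCount a.onLeaves = fixCount b.onLeaves then
        (fixCount a.onLeaves)! * (n - fixCount a.onLeaves)‼ else 0 := by
    rw [← hs, ← Leaves.card s]
    exact Finset.sum_le_sum fun a _ => Finset.sum_le_sum fun b _ =>
      card_intertwine_le a.onLeaves b.onLeaves
  rw [h] at h'
  refine h'.trans ?_
  refine le_of_eq (Finset.sum_congr rfl fun m _ => ?_)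
  rw [autCount, autCount]

/-- Only the triples in which both automorphisms are products of cherry swaps are kept; these are
involutions, for which the intertwining count is exact. -/
theorem le_intertwineCount {s t : BinaryTree Unit} {n : ℕ} (hs : s.numLeaves = n)
    (ht : t.numLeaves = n) :
    ∑ m ∈ Finset.range (n + 1), m ! * (n - m)‼ * (cherrySwapCount s m * cherrySwapCount t m) ≤
      intertwineCount s t := by
  classical
  have h := sum_ite_fixCount_eq (Finset.univ.filter fun e : TreeIso s s => e.IsCherrySwap)
    (Finset.univ.filter fun e : TreeIso t t => e.IsCherrySwap) (fun e => fixCount e.onLeaves)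
    (fun e => fixCount e.onLeaves) (fun m => m ! * (n - m)‼) n
    (fun e _ => (fixCount_le_card _).trans_eq ((Leaves.card s).trans hs))
  have h' : ∀ m, m ! * (n - m)‼ * (cherrySwapCount s m * cherrySwapCount t m) =
      m ! * (n - m)‼ * (((Finset.univ.filter fun e : TreeIso s s => e.IsCherrySwap).filter
        fun e => fixCount e.onLeaves = m).card * ((Finset.univ.filter fun e : TreeIso t t =>
          e.IsCherrySwap).filter fun e => fixCount e.onLeaves = m).card) := by
    intro m
    rw [cherrySwapCount, cherrySwapCount, Finset.filter_filter, Finset.filter_filter]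
  rw [Finset.sum_congr rfl fun m _ => h' m, ← h, intertwineCount]
  refine le_trans ?_ (Finset.sum_le_sum_of_subset (Finset.filter_subset
    (fun e : TreeIso s s => e.IsCherrySwap) _))
  refine Finset.sum_le_sum fun a ha => ?_
  refine le_trans ?_ (Finset.sum_le_sum_of_subset (Finset.filter_subset
    (fun e : TreeIso t t => e.IsCherrySwap) _))
  refine Finset.sum_le_sum fun b hb => le_of_eq ?_
  rw [card_intertwine_of_involutive a.onLeaves b.onLeaves (Finset.mem_filter.1 ha).2.involutive
    (Finset.mem_filter.1 hb).2.involutive (by rw [Leaves.card, Leaves.card, hs, ht]), Leaves.card,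
    hs]

/-! ### Generating polynomials by the number of fixed leaves. -/

open scoped Nat Polynomial

theorem fixCount_sumCongr {α β : Type*} [Fintype α] [DecidableEq α] [Fintype β] [DecidableEq β]
    (a : α ≃ α) (b : β ≃ β) : fixCount (Equiv.sumCongr a b) = fixCount a + fixCount b := by
  simp only [fixCount, Finset.card_filter, Fintype.sum_sum_type, Equiv.sumCongr_apply,
    Sum.map_inl, Sum.map_inr, Sum.inl.injEq, Sum.inr.injEq]

theorem fixCount_inl {a : Unit} {l r : BinaryTree Unit} (e : TreeIso l l × TreeIso r r) :
    fixCount (TreeIso.onLeaves (s := .node a l r) (t := .node a l r) (.inl e)) =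
      fixCount e.1.onLeaves + fixCount e.2.onLeaves :=
  fixCount_sumCongr _ _

theorem fixCount_inr {a : Unit} {l r : BinaryTree Unit} (e : TreeIso l r × TreeIso r l) :
    fixCount (TreeIso.onLeaves (s := .node a l r) (t := .node a l r) (.inr e)) = 0 := by
  rw [fixCount, Finset.card_eq_zero, Finset.filter_eq_empty_iff]
  rintro (x | x) - h
  · exact Sum.inr_ne_inl h
  · exact Sum.inl_ne_inr h

/-- The generating polynomial of the automorphisms of a tree by the number of fixed leaves. -/
noncomputable def autPoly (t : BinaryTree Unit) : ℝ[X] :=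
  ∑ e : TreeIso t t, Polynomial.X ^ fixCount e.onLeaves

open Classical in
/-- The generating polynomial of the products of cherry swaps of a tree by the number of fixed
leaves. -/
noncomputable def cherrySwapPoly (t : BinaryTree Unit) : ℝ[X] :=
  ∑ e : TreeIso t t with e.IsCherrySwap, Polynomial.X ^ fixCount e.onLeaves

theorem coeff_autPoly (t : BinaryTree Unit) (m : ℕ) : (autPoly t).coeff m = autCount t m := by
  simp only [autPoly, autCount, Polynomial.finsetSum_coeff, Polynomial.coeff_X_pow,
    Finset.card_filter, Nat.cast_sum, Nat.cast_ite, Nat.cast_one, Nat.cast_zero]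
  exact Finset.sum_congr rfl fun e _ => by simp only [eq_comm]

theorem coeff_cherrySwapPoly (t : BinaryTree Unit) (m : ℕ) :
    (cherrySwapPoly t).coeff m = cherrySwapCount t m := by
  classical
  rw [cherrySwapPoly, cherrySwapCount, ← Finset.filter_filter, Finset.card_filter]
  simp only [Polynomial.finsetSum_coeff, Polynomial.coeff_X_pow, Nat.cast_sum, Nat.cast_ite,
    Nat.cast_one, Nat.cast_zero]
  exact Finset.sum_congr rfl fun e _ => by simp only [eq_comm]

theorem autPoly_nil : autPoly .nil = Polynomial.X := by
  refine (Fintype.sum_unique (ι := Unit) _).trans ?_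
  exact pow_one _

/-- An automorphism that exchanges the branches at the root fixes no leaf, so all of these
contribute to the constant term. -/
theorem autPoly_node (a : Unit) (l r : BinaryTree Unit) :
    autPoly (.node a l r) = autPoly l * autPoly r +
      Polynomial.C (Fintype.card (TreeIso l r) * Fintype.card (TreeIso r l) : ℝ) := by
  refine (Fintype.sum_sum_type (α₁ := TreeIso l l × TreeIso r r)
    (α₂ := TreeIso l r × TreeIso r l) _).trans ?_
  congr 1
  · rw [autPoly, autPoly, Finset.sum_mul_sum, ← Finset.sum_product']
    refine Finset.sum_congr rfl fun e _ => ?_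
    rw [← pow_add]
    exact congrArg _ (fixCount_inl e)
  · rw [Finset.sum_congr rfl fun e _ => congrArg _ (fixCount_inr e)]
    simp

theorem cherrySwapPoly_nil : cherrySwapPoly .nil = Polynomial.X := by
  classical
  have h : (Finset.univ.filter fun e : TreeIso .nil .nil => e.IsCherrySwap) = Finset.univ :=
    Finset.filter_true_of_mem fun _ _ => trivial
  rw [cherrySwapPoly, h]
  refine (Fintype.sum_unique (ι := Unit) _).trans ?_
  exact pow_one _

open Classical in
theorem cherrySwapPoly_node (a : Unit) (l r : BinaryTree Unit) :
    cherrySwapPoly (.node a l r) = cherrySwapPoly l * cherrySwapPoly r +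
      Polynomial.C (if l = .nil ∧ r = .nil then 1 else 0 : ℝ) := by
  rw [cherrySwapPoly, Finset.sum_filter]
  refine (Fintype.sum_sum_type (α₁ := TreeIso l l × TreeIso r r)
    (α₂ := TreeIso l r × TreeIso r l) _).trans ?_
  congr 1
  · rw [cherrySwapPoly, cherrySwapPoly, Finset.sum_mul_sum, ← Finset.sum_product',
      ← Finset.filter_product, Finset.sum_filter]
    refine Finset.sum_congr rfl fun e _ => ?_
    rw [← pow_add]
    exact if_congr Iff.rfl (congrArg (fun k => (Polynomial.X ^ k : ℝ[X])) (fixCount_inl e)) rfl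
  · have : ∀ e : TreeIso l r × TreeIso r l,
        (if TreeIso.IsCherrySwap (t := .node a l r) (.inr e) then (Polynomial.X ^ fixCount
          (TreeIso.onLeaves (s := .node a l r) (t := .node a l r) (.inr e)) : ℝ[X]) else 0) =
        if l = .nil ∧ r = .nil then 1 else 0 := fun e => by
      rw [fixCount_inr, pow_zero]
      exact if_congr Iff.rfl rfl rfl
    refine (Finset.sum_congr rfl fun e _ => this e).trans ?_
    split_ifs with h
    · obtain ⟨rfl, rfl⟩ := h
      rw [map_one, Finset.sum_const]
      exact one_smul ℕ _
    · simp

/-! ### The functional equation `G = W + G²` and its coefficients. -/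

section Series

/-- A solution of `G = W + G ^ 2` is the catalan series evaluated at `W`. -/
theorem coeff_eq_of_eq_add_sq {R : Type*} [CommRing R] [IsDomain R] {G W : PowerSeries R}
    (hG : PowerSeries.constantCoeff G = 0) (h : G = W + G ^ 2) (n : ℕ) :
    PowerSeries.coeff n G =
      ∑ k ∈ Finset.range n, (catalan k : R) * PowerSeries.coeff n (W ^ (k + 1)) := by
  have hW : PowerSeries.constantCoeff W = 0 := by
    have := congrArg PowerSeries.constantCoeff h
    simpa [hG] using this.symm
  have hs : PowerSeries.HasSubst W := PowerSeries.HasSubst.of_constantCoeff_zero' hW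
  let c : PowerSeries R := PowerSeries.mk fun n => (catalan n : R)
  have hc : c = 1 + PowerSeries.X * c ^ 2 := by
    ext n
    cases n with
    | zero => simp [c]
    | succ n =>
      rw [map_add, PowerSeries.coeff_succ_X_mul, pow_two, PowerSeries.coeff_mul]
      simp only [c, PowerSeries.coeff_mk, PowerSeries.coeff_one, catalan_succ']
      simp
  let F := PowerSeries.X * c
  have hF : F = PowerSeries.X + F ^ 2 := by
    change PowerSeries.X * c = PowerSeries.X + (PowerSeries.X * c) ^ 2
    conv_lhs => rw [hc]
    ring
  let H := F.subst W
  have hH : H = W + H ^ 2 := by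
    have := congrArg (PowerSeries.subst W) hF
    rwa [PowerSeries.subst_add hs, PowerSeries.subst_pow hs, PowerSeries.subst_X hs] at this
  have hH0 : PowerSeries.constantCoeff H = 0 :=
    PowerSeries.constantCoeff_subst_eq_zero hW F (by simp [F])
  -- Both series solve the same quadratic equation. Their difference times `1 - G - H` vanishes, and
  -- the latter has constant coefficient `1`.
  have hGH : G = H := by
    have h1 : (G - H) * (1 - G - H) = 0 := by
      linear_combination h - hH
    rcases mul_eq_zero.1 h1 with h2 | h2
    · exact sub_eq_zero.1 h2
    · have := congrArg PowerSeries.constantCoeff h2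
      simp [hG, hH0] at this
  have hWd : ∀ d, n < d → PowerSeries.coeff n (W ^ d) = 0 := fun d hd =>
    PowerSeries.X_pow_dvd_iff.1 (pow_dvd_pow_of_dvd (PowerSeries.X_dvd_iff.2 hW) d) n hd
  rw [hGH, PowerSeries.coeff_subst' hs, finsum_eq_sum_of_support_subset (s := Finset.range (n + 1)),
    Finset.sum_range_succ']
  · simp [F, c, PowerSeries.coeff_succ_X_mul]
  · intro d hd
    by_contra hdn
    refine hd ?_
    beta_reduce
    rw [hWd d (by simpa using hdn), smul_zero]

end Series

open BinaryTree (treesOfNumNodesEq)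

theorem sum_treesOfNumNodesEq_succ {M : Type*} [AddCommMonoid M] (n : ℕ)
    (f : BinaryTree Unit → M) :
    ∑ t ∈ treesOfNumNodesEq (n + 1), f t =
      ∑ p ∈ Finset.HasAntidiagonal.antidiagonal n, ∑ l ∈ treesOfNumNodesEq p.1, ∑ r ∈ treesOfNumNodesEq p.2,
        f (.node () l r) := by
  rw [BinaryTree.treesOfNumNodesEq_succ, Finset.sum_biUnion]
  · refine Finset.sum_congr rfl fun p _ => ?_
    rw [Finset.sum_map, Finset.sum_product]
    rfl
  · simp_rw [Set.PairwiseDisjoint, Set.Pairwise, Finset.disjoint_left]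
    aesop

/-- The sum of a function over the plane binary trees with `n` leaves. -/
noncomputable def leafSum (g : BinaryTree Unit → ℝ[X]) : ℕ → ℝ[X]
  | 0 => 0
  | n + 1 => ∑ t ∈ treesOfNumNodesEq n, g t

/-- The sum of a function of two trees over all pairs with `n` internal vertices in total. -/
noncomputable def pairSum (c : BinaryTree Unit → BinaryTree Unit → ℝ) (n : ℕ) : ℝ :=
  ∑ p ∈ Finset.HasAntidiagonal.antidiagonal n, ∑ l ∈ treesOfNumNodesEq p.1, ∑ r ∈ treesOfNumNodesEq p.2, c l r

section

variable {g : BinaryTree Unit → ℝ[X]} {c : BinaryTree Unit → BinaryTree Unit → ℝ}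

/-- Decomposition at the root, with the series variable marking leaves and the polynomial variable
marking fixed leaves. The factor `X ^ 2` is there because two branches with `k` internal vertices in
total have `k + 2` leaves. -/
theorem mk_leafSum (h0 : g .nil = Polynomial.X)
    (h1 : ∀ l r, g (.node () l r) = g l * g r + Polynomial.C (c l r)) :
    PowerSeries.mk (leafSum g) =
      (PowerSeries.C Polynomial.X * PowerSeries.X + PowerSeries.X ^ 2 *
        PowerSeries.map Polynomial.C (PowerSeries.mk (pairSum c))) +
      PowerSeries.mk (leafSum g) ^ 2 := by
  ext1 n
  rw [pow_two (PowerSeries.mk (leafSum g)), map_add, map_add, PowerSeries.coeff_C_mul,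
    PowerSeries.coeff_X, PowerSeries.coeff_X_pow_mul', PowerSeries.coeff_mul]
  simp only [PowerSeries.coeff_mk, PowerSeries.coeff_map]
  match n with
  | 0 => simp [leafSum]
  | 1 => simp [leafSum, h0, Finset.Nat.antidiagonal_succ]
  | n + 2 =>
    rw [Finset.Nat.antidiagonal_succ_succ']
    simp only [leafSum, sum_treesOfNumNodesEq_succ, h1, Finset.sum_add_distrib, pairSum, map_sum,
      Finset.sum_cons, Finset.sum_map, zero_mul, mul_zero, zero_add]
    simp [Finset.sum_mul_sum, add_comm]

theorem coeff_coeff_pow (V : PowerSeries ℝ) (d n m : ℕ) :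
    (PowerSeries.coeff n ((PowerSeries.C Polynomial.X * PowerSeries.X + PowerSeries.X ^ 2 *
      PowerSeries.map Polynomial.C V) ^ d)).coeff m =
      if m ≤ d ∧ 2 * d ≤ n + m then
        (d.choose m : ℝ) * PowerSeries.coeff (n + m - 2 * d) (V ^ (d - m)) else 0 := by
  have key : ∀ i ∈ Finset.range (d + 1), (PowerSeries.coeff n
      ((PowerSeries.C Polynomial.X * PowerSeries.X) ^ i * (PowerSeries.X ^ 2 *
        PowerSeries.map Polynomial.C V) ^ (d - i) * ((d.choose i : ℕ) : PowerSeries ℝ[X]))).coeff m =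
      if i = m then (if 2 * d ≤ n + m then
        (d.choose m : ℝ) * PowerSeries.coeff (n + m - 2 * d) (V ^ (d - m)) else 0) else 0 := by
    intro i hi
    have hi : i ≤ d := Nat.lt_succ_iff.1 (Finset.mem_range.1 hi)
    have : (PowerSeries.C Polynomial.X * PowerSeries.X) ^ i * (PowerSeries.X ^ 2 *
        PowerSeries.map Polynomial.C V) ^ (d - i) * ((d.choose i : ℕ) : PowerSeries ℝ[X]) =
        PowerSeries.X ^ (2 * d - i) * (PowerSeries.C (Polynomial.C (d.choose i : ℝ) *
          Polynomial.X ^ i) * PowerSeries.map Polynomial.C (V ^ (d - i))) := by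
      obtain ⟨j, rfl⟩ := Nat.exists_eq_add_of_le hi
      rw [show 2 * (i + j) - i = i + 2 * j by omega, Nat.add_sub_cancel_left]
      simp only [map_mul, map_pow, map_natCast]
      ring
    rw [this, PowerSeries.coeff_X_pow_mul']
    by_cases h : 2 * d - i ≤ n
    · rw [if_pos h, PowerSeries.coeff_C_mul, PowerSeries.coeff_map, mul_right_comm,
        ← Polynomial.C_mul, Polynomial.coeff_C_mul, Polynomial.coeff_X_pow]
      by_cases him : i = m
      · subst him
        rw [if_pos rfl, if_pos rfl, if_pos (by omega), mul_one]
        congr 3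
        omega
      · rw [if_neg (Ne.symm him), if_neg him, mul_zero]
    · rw [if_neg h, Polynomial.coeff_zero]
      split_ifs
      · omega
      · rfl
      · rfl
  rw [add_pow, map_sum, Polynomial.finsetSum_coeff, Finset.sum_congr rfl key, Finset.sum_ite_eq']
  by_cases hm : m ≤ d
  · simp [hm]
  · simp [hm]

/-- Cutting at the topmost exchanged vertices leaves a plane tree with `m + j` leaves, of which `m`
are fixed leaves and `j` stand for exchanged pairs. There are `catalan (m + j - 1)` shapes and `(m +
j).choose m` placements, and the `j` pairs account for the power of the series of `pairSum c`. -/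
theorem coeff_leafSum (h0 : g .nil = Polynomial.X)
    (h1 : ∀ l r, g (.node () l r) = g l * g r + Polynomial.C (c l r)) (m q : ℕ)
    (hmq : 0 < m + q) :
    (leafSum g (m + 2 * q)).coeff m = ∑ j ∈ Finset.range (q + 1),
      (catalan (m + j - 1) : ℝ) * ((m + j).choose m *
        PowerSeries.coeff (2 * (q - j)) (PowerSeries.mk (pairSum c) ^ j)) := by
  have h := coeff_eq_of_eq_add_sq (by simp [leafSum]) (mk_leafSum h0 h1) (m + 2 * q)
  rw [PowerSeries.coeff_mk] at h
  rw [h, Polynomial.finsetSum_coeff]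
  have h2 : ∀ k, ((catalan k : ℝ[X]) * PowerSeries.coeff (m + 2 * q)
      ((PowerSeries.C Polynomial.X * PowerSeries.X + PowerSeries.X ^ 2 *
      PowerSeries.map Polynomial.C (PowerSeries.mk (pairSum c))) ^ (k + 1))).coeff m =
      (catalan (k + 1 - 1) : ℝ) * if m ≤ k + 1 ∧ 2 * (k + 1) ≤ m + 2 * q + m then
        ((k + 1).choose m : ℝ) * PowerSeries.coeff (m + 2 * q + m - 2 * (k + 1))
          (PowerSeries.mk (pairSum c) ^ (k + 1 - m)) else 0 := by
    intro k
    rw [← Polynomial.C_eq_natCast, Polynomial.coeff_C_mul, coeff_coeff_pow]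
    rfl
  simp_rw [h2]
  have h3 := Finset.sum_range_succ' (fun d => (catalan (d - 1) : ℝ) *
    if m ≤ d ∧ 2 * d ≤ m + 2 * q + m then (d.choose m : ℝ) *
      PowerSeries.coeff (m + 2 * q + m - 2 * d) (PowerSeries.mk (pairSum c) ^ (d - m)) else 0)
    (m + 2 * q)
  -- The Catalan sum starts at the first power of `W`. Including the zeroth power changes nothing,
  -- because `m + q > 0` makes its coefficient vanish.
  have h4 : (if m ≤ 0 ∧ 2 * 0 ≤ m + 2 * q + m then (Nat.choose 0 m : ℝ) *
      PowerSeries.coeff (m + 2 * q + m - 2 * 0) (PowerSeries.mk (pairSum c) ^ (0 - m)) else 0) =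
      0 := by
    split_ifs with hm
    · obtain rfl : m = 0 := by omega
      rw [pow_zero, PowerSeries.coeff_one, if_neg (by omega), mul_zero]
    · rfl
  rw [h4, mul_zero, add_zero] at h3
  rw [← h3, add_assoc, Finset.sum_range_add, Finset.sum_eq_zero, zero_add]
  · symm
    refine (Finset.sum_congr rfl fun j hj => ?_).trans (Finset.sum_subset
      (Finset.range_subset_range.2 (by omega : q + 1 ≤ 2 * q + 1)) fun j _ hj => ?_)
    · have : j ≤ q := Nat.lt_succ_iff.1 (Finset.mem_range.1 hj)
      rw [if_pos (by omega), Nat.add_sub_cancel_left]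
      congr 4
      omega
    · rw [Finset.mem_range] at hj
      rw [if_neg (by omega), mul_zero]
  · intro d hd
    rw [Finset.mem_range] at hd
    rw [if_neg (by omega), mul_zero]

end

theorem coeff_leafSum_autPoly (n m : ℕ) :
    (leafSum autPoly (n + 1)).coeff m = ∑ t ∈ treesOfNumNodesEq n, (autCount t m : ℝ) := by
  simp only [leafSum, Polynomial.finsetSum_coeff, coeff_autPoly]

theorem coeff_leafSum_cherrySwapPoly (n m : ℕ) :
    (leafSum cherrySwapPoly (n + 1)).coeff m =
      ∑ t ∈ treesOfNumNodesEq n, (cherrySwapCount t m : ℝ) := by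
  simp only [leafSum, Polynomial.finsetSum_coeff, coeff_cherrySwapPoly]

open Classical in
theorem pairSum_cherry :
    PowerSeries.mk (pairSum fun l r => if l = .nil ∧ r = .nil then 1 else 0) = 1 := by
  ext n
  rw [PowerSeries.coeff_mk, PowerSeries.coeff_one, pairSum]
  split_ifs with h
  · subst h
    simp [Finset.filter_singleton]
  · refine Finset.sum_eq_zero fun p hp => Finset.sum_eq_zero fun l hl =>
      Finset.sum_eq_zero fun r hr => if_neg ?_
    rintro ⟨rfl, rfl⟩
    rw [BinaryTree.mem_treesOfNumNodesEq] at hl hr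
    rw [Finset.HasAntidiagonal.mem_antidiagonal] at hp
    simp only [BinaryTree.numNodes] at hl hr
    omega

/-- The number of plane trees with `m + 2 * q` leaves and `q` marked cherries. -/
theorem coeff_leafSum_cherry (m q : ℕ) (h : 0 < m + q) :
    (leafSum cherrySwapPoly (m + 2 * q)).coeff m =
      (catalan (m + q - 1) : ℝ) * (m + q).choose m := by
  classical
  rw [coeff_leafSum cherrySwapPoly_nil (cherrySwapPoly_node ()) m q h, pairSum_cherry,
    Finset.sum_range_succ, Finset.sum_eq_zero, zero_add]
  · simp
  · intro j hj
    rw [Finset.mem_range] at hj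
    rw [one_pow, PowerSeries.coeff_one, if_neg (by omega), mul_zero, mul_zero]

/-! ### Exponential bounds for the series of exchanged pairs of branches. -/

theorem card_treeIso_le (s t : BinaryTree Unit) :
    Fintype.card (TreeIso s t) ≤ 2 ^ s.numNodes := by
  have h := TreeIso.finite_sigma_and_card s
  have := h.1
  rw [← h.2, ← Nat.card_eq_fintype_card]
  exact Nat.card_le_card_of_injective (fun e => (⟨t, e⟩ : Σ t, TreeIso s t))
    (sigma_mk_injective)

theorem catalan_le_four_pow (n : ℕ) : catalan n ≤ 4 ^ n := by
  have h1 := succ_mul_catalan_eq_centralBinom n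
  have h2 : n.centralBinom ≤ 4 ^ n := by
    rw [Nat.centralBinom_eq_two_mul_choose]
    calc (2 * n).choose n ≤ 2 ^ (2 * n) := Nat.choose_le_two_pow _ _
      _ = 4 ^ n := by rw [pow_mul]; norm_num
  nlinarith

/-- The number of pairs of an isomorphism from `l` to `r` and an isomorphism from `r` to `l`. -/
noncomputable def swapWeight (l r : BinaryTree Unit) : ℝ :=
  Fintype.card (TreeIso l r) * Fintype.card (TreeIso r l)

/-- For fixed `l` the isomorphisms to all `r` number `2 ^ n`, those back from each `r` at most `2 ^
n`, and there are at most `4 ^ n` trees `l`. -/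
theorem sum_swapWeight_le (n : ℕ) :
    ∑ l ∈ treesOfNumNodesEq n, ∑ r ∈ treesOfNumNodesEq n, swapWeight l r ≤ 16 ^ n := by
  have h : ∀ l ∈ treesOfNumNodesEq n, ∑ r ∈ treesOfNumNodesEq n, swapWeight l r ≤ 4 ^ n := by
    intro l hl
    have hl' := BinaryTree.mem_treesOfNumNodesEq.1 hl
    calc ∑ r ∈ treesOfNumNodesEq n, swapWeight l r
        ≤ ∑ r ∈ treesOfNumNodesEq n, (Fintype.card (TreeIso l r) : ℝ) * 2 ^ n := by
          refine Finset.sum_le_sum fun r hr => ?_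
          refine mul_le_mul_of_nonneg_left ?_ (Nat.cast_nonneg _)
          have := card_treeIso_le r l
          rw [BinaryTree.mem_treesOfNumNodesEq.1 hr] at this
          exact_mod_cast this
      _ = 2 ^ n * 2 ^ n := by
          rw [← Finset.sum_mul, ← sum_planeTree]
          have := sum_card_treeIso (n := n)
            ⟨l, by rw [BinaryTree.numLeaves_eq_numNodes_succ, hl']⟩
          simp only [Nat.card_eq_fintype_card] at this
          congr 1
          exact_mod_cast this
      _ = 4 ^ n := by
          rw [← mul_pow]
          norm_num
  calc ∑ l ∈ treesOfNumNodesEq n, ∑ r ∈ treesOfNumNodesEq n, swapWeight l r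
      ≤ ∑ l ∈ treesOfNumNodesEq n, (4 : ℝ) ^ n := Finset.sum_le_sum h
    _ = catalan n * 4 ^ n := by
      rw [Finset.sum_const, BinaryTree.treesOfNumNodesEq_card_eq_catalan, nsmul_eq_mul]
    _ ≤ 4 ^ n * 4 ^ n := by
      refine mul_le_mul_of_nonneg_right ?_ (by positivity)
      exact_mod_cast catalan_le_four_pow n
    _ = 16 ^ n := by
      rw [← mul_pow]
      norm_num

theorem swapWeight_nonneg (l r : BinaryTree Unit) : 0 ≤ swapWeight l r := by
  unfold swapWeight
  positivity

theorem pairSum_swapWeight_nonneg (n : ℕ) : 0 ≤ pairSum swapWeight n :=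
  Finset.sum_nonneg fun _ _ => Finset.sum_nonneg fun _ _ => Finset.sum_nonneg fun _ _ =>
    swapWeight_nonneg _ _

/-- Isomorphic branches have equal size, so only the diagonal pair of sizes `(a, a)` with `n = 2a`
survives, and `16 ^ a = 4 ^ n`. -/
theorem pairSum_swapWeight_le (n : ℕ) : pairSum swapWeight n ≤ 4 ^ n := by
  have h0 : ∀ p ∈ Finset.HasAntidiagonal.antidiagonal n, p.1 ≠ p.2 →
      ∑ l ∈ treesOfNumNodesEq p.1, ∑ r ∈ treesOfNumNodesEq p.2, swapWeight l r = 0 := by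
    intro p _ hp
    refine Finset.sum_eq_zero fun l hl => Finset.sum_eq_zero fun r hr => ?_
    rw [BinaryTree.mem_treesOfNumNodesEq] at hl hr
    have : IsEmpty (TreeIso l r) := ⟨fun e => by
      have := e.numLeaves_eq
      rw [BinaryTree.numLeaves_eq_numNodes_succ, BinaryTree.numLeaves_eq_numNodes_succ] at this
      omega⟩
    simp [swapWeight]
  rw [pairSum]
  rcases Nat.even_or_odd n with ⟨a, rfl⟩ | hn
  · rw [Finset.sum_eq_single (a, a)]
    · calc _ ≤ (16 : ℝ) ^ a := sum_swapWeight_le a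
        _ = 4 ^ (a + a) := by
          rw [pow_add, ← mul_pow]
          norm_num
    · rintro ⟨i, j⟩ hp hne
      refine h0 _ hp fun hij => hne ?_
      rw [Finset.HasAntidiagonal.mem_antidiagonal] at hp
      simp only [Prod.mk.injEq] at hij hp ⊢
      omega
    · intro h
      simp at h
  · rw [Finset.sum_eq_zero fun p hp => h0 p hp fun h => ?_]
    · positivity
    · rw [Finset.HasAntidiagonal.mem_antidiagonal] at hp
      obtain ⟨k, rfl⟩ := hn
      omega

theorem coeff_pairSum_pow_nonneg (j n : ℕ) :
    0 ≤ PowerSeries.coeff n (PowerSeries.mk (pairSum swapWeight) ^ j) := by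
  induction j generalizing n with
  | zero =>
    rw [pow_zero, PowerSeries.coeff_one]
    split_ifs <;> norm_num
  | succ j ih =>
    rw [pow_succ, PowerSeries.coeff_mul]
    refine Finset.sum_nonneg fun p _ => mul_nonneg (ih _) ?_
    rw [PowerSeries.coeff_mk]
    exact pairSum_swapWeight_nonneg _

/-- Weakening `4 ^ n` to `8 ^ n` turns each convolution into a geometric series of ratio `1 / 2`, so
every further factor costs only a constant `2`. -/
theorem coeff_pairSum_pow_le (j n : ℕ) :
    PowerSeries.coeff n (PowerSeries.mk (pairSum swapWeight) ^ j) ≤ 2 ^ j * 8 ^ n := by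
  induction j generalizing n with
  | zero =>
    rw [pow_zero, PowerSeries.coeff_one, pow_zero, one_mul]
    split_ifs
    · exact one_le_pow₀ (by norm_num)
    · positivity
  | succ j ih =>
    rw [pow_succ, PowerSeries.coeff_mul]
    calc ∑ p ∈ Finset.HasAntidiagonal.antidiagonal n,
          PowerSeries.coeff p.1 (PowerSeries.mk (pairSum swapWeight) ^ j) *
            PowerSeries.coeff p.2 (PowerSeries.mk (pairSum swapWeight))
        ≤ ∑ p ∈ Finset.HasAntidiagonal.antidiagonal n, (2 ^ j * 8 ^ n) * (1 / 2 : ℝ) ^ p.2 := by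
          refine Finset.sum_le_sum fun p hp => ?_
          rw [Finset.HasAntidiagonal.mem_antidiagonal] at hp
          rw [PowerSeries.coeff_mk]
          calc _ ≤ (2 ^ j * 8 ^ p.1) * (4 : ℝ) ^ p.2 :=
                mul_le_mul (ih _) (pairSum_swapWeight_le _) (pairSum_swapWeight_nonneg _)
                  (by positivity)
            _ = (2 ^ j * 8 ^ n) * (1 / 2 : ℝ) ^ p.2 := by
                rw [← hp, pow_add, mul_assoc, mul_assoc, mul_assoc, ← mul_pow]
                norm_num
      _ = (2 ^ j * 8 ^ n) * ∑ i ∈ Finset.range (n + 1), (1 / 2 : ℝ) ^ i := by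
          rw [← Finset.mul_sum, Finset.Nat.sum_antidiagonal_eq_sum_range_succ_mk,
            ← Finset.sum_range_reflect]
          congr 1
          refine Finset.sum_congr rfl fun i hi => ?_
          rw [Finset.mem_range] at hi
          congr 1
          simp only
          omega
      _ ≤ (2 ^ j * 8 ^ n) * 2 := by
          refine mul_le_mul_of_nonneg_left ?_ (by positivity)
          have := geom_sum_eq (show (1 / 2 : ℝ) ≠ 1 by norm_num) (n + 1)
          rw [this, div_le_iff_of_neg (by norm_num)]
          have : (0 : ℝ) ≤ (1 / 2) ^ (n + 1) := by positivity
          linarith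
      _ = 2 ^ (j + 1) * 8 ^ n := by ring

/-! ### Parity of the fixed leaves, and cherry swaps counted by cherries. -/

/-- Exchanged branches have equally many leaves and none of them is fixed. Hence only `m = n - 2q`
fixed leaves can occur among `n`, and sums over `m` become sums over `q`. -/
theorem TreeIso.even_numLeaves_add_fixCount {t : BinaryTree Unit} (e : TreeIso t t) :
    Even (t.numLeaves + fixCount e.onLeaves) := by
  induction t with
  | nil => exact ⟨1, rfl⟩
  | node a l r hl hr =>
    rcases e with e | e
    · have := (hl e.1).add (hr e.2)
      rw [fixCount_inl, BinaryTree.numLeaves]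
      rwa [add_add_add_comm] at this
    · rw [fixCount_inr, BinaryTree.numLeaves, e.1.numLeaves_eq]
      exact ⟨_, rfl⟩

theorem autCount_eq_zero {t : BinaryTree Unit} {m : ℕ} (h : ¬ Even (t.numLeaves + m)) :
    autCount t m = 0 := by
  rw [autCount, Finset.card_eq_zero, Finset.filter_eq_empty_iff]
  rintro e - rfl
  exact h e.even_numLeaves_add_fixCount

theorem cherrySwapCount_le_autCount (t : BinaryTree Unit) (m : ℕ) :
    cherrySwapCount t m ≤ autCount t m := by
  classical
  rw [cherrySwapCount, autCount]
  refine Finset.card_le_card fun e he => ?_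
  rw [Finset.mem_filter] at he ⊢
  exact ⟨he.1, he.2.2⟩

theorem sum_range_eq_sum_of_even {n : ℕ} (F : ℕ → ℝ) (h : ∀ m, ¬ Even (n + m) → F m = 0) :
    ∑ m ∈ Finset.range (n + 1), F m = ∑ q ∈ Finset.range (n / 2 + 1), F (n - 2 * q) := by
  have : ∑ m ∈ Finset.range (n + 1), F m =
      ∑ m ∈ (Finset.range (n + 1)).filter fun m => Even (n + m), F m := by
    refine (Finset.sum_subset (Finset.filter_subset _ _) fun m hm hm' => h m fun he => hm' ?_).symm
    exact Finset.mem_filter.2 ⟨hm, he⟩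
  rw [this]
  refine Finset.sum_nbij' (fun m => (n - m) / 2) (fun q => n - 2 * q) ?_ ?_ ?_ ?_ ?_
  all_goals
    simp only [Finset.mem_filter, Finset.mem_range]
    intro m hm
  · omega
  · refine ⟨by omega, ⟨n - m, by omega⟩⟩
  · obtain ⟨hm, k, hk⟩ := hm
    omega
  · omega
  · obtain ⟨hm, k, hk⟩ := hm
    congr 1
    omega

/-- The number of cherries of a plane binary tree: the vertices whose children are both leaves. -/
def cherries : BinaryTree Unit → ℕ
  | .nil => 0
  | .node _ l r => if l = .nil ∧ r = .nil then 1 else cherries l + cherries r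

theorem two_mul_cherries_le (t : BinaryTree Unit) : 2 * cherries t ≤ t.numLeaves := by
  induction t with
  | nil => simp [cherries]
  | node a l r hl hr =>
    rw [cherries, BinaryTree.numLeaves]
    have := l.numLeaves_pos
    have := r.numLeaves_pos
    split_ifs <;> omega

/-- Each cherry is independently fixed or exchanged and contributes the factor `X² + 1`; each leaf
outside the cherries contributes `X`. -/
theorem cherrySwapPoly_eq (t : BinaryTree Unit) :
    cherrySwapPoly t = Polynomial.X ^ (t.numLeaves - 2 * cherries t) *
      Polynomial.expand ℝ 2 ((Polynomial.X + 1) ^ cherries t) := by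
  induction t with
  | nil => simp [cherries, cherrySwapPoly_nil]
  | node a l r hl hr =>
    rw [cherrySwapPoly_node, cherries, BinaryTree.numLeaves]
    split_ifs with h
    · obtain ⟨rfl, rfl⟩ := h
      simp [cherrySwapPoly_nil]
      ring
    · have h1 := two_mul_cherries_le l
      have h2 := two_mul_cherries_le r
      rw [hl, hr, map_zero, add_zero, pow_add, map_mul,
        show l.numLeaves + r.numLeaves - 2 * (cherries l + cherries r) =
          (l.numLeaves - 2 * cherries l) + (r.numLeaves - 2 * cherries r) by omega, pow_add]
      ring

theorem cherrySwapCount_eq {t : BinaryTree Unit} {n q : ℕ} (ht : t.numLeaves = n)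
    (hq : 2 * q ≤ n) : cherrySwapCount t (n - 2 * q) = (cherries t).choose q := by
  have h := coeff_cherrySwapPoly t (n - 2 * q)
  have h1 := two_mul_cherries_le t
  rw [cherrySwapPoly_eq, Polynomial.coeff_X_pow_mul', ht] at h
  rw [ht] at h1
  rcases le_or_gt q (cherries t) with hqc | hqc
  · rw [if_pos (by omega), show n - 2 * q - (n - 2 * cherries t) = (cherries t - q) * 2 by omega,
      Polynomial.coeff_expand_mul (by norm_num), Polynomial.coeff_X_add_one_pow,
      Nat.choose_symm hqc] at h
    exact_mod_cast h.symm
  · rw [if_neg (by omega)] at h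
    rw [Nat.choose_eq_zero_of_lt hqc]
    exact_mod_cast h.symm

/-- The number of triples of products of cherry swaps of two trees with `n` leaves, `c` and `d`
cherries, and an intertwining bijection of the leaves, divided by `n!`. -/
noncomputable def cherryWeight (n c d : ℕ) : ℝ :=
  ∑ q ∈ Finset.range (n / 2 + 1),
    ((n - 2 * q)! * (2 ^ q * q !) : ℝ) * (c.choose q * d.choose q) / n !

theorem doubleFactorial_weight {n q : ℕ} (hq : q ∈ Finset.range (n / 2 + 1)) :
    (((n - 2 * q)! * (n - (n - 2 * q))‼ : ℕ) : ℝ) = (n - 2 * q)! * (2 ^ q * q !) := by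
  rw [Finset.mem_range] at hq
  rw [show n - (n - 2 * q) = 2 * q by omega, Nat.doubleFactorial_two_mul]
  push_cast
  ring

theorem cherryWeight_le_intertwineCount {s t : BinaryTree Unit} {n : ℕ} (hs : s.numLeaves = n)
    (ht : t.numLeaves = n) :
    cherryWeight n (cherries s) (cherries t) ≤ intertwineCount s t / n ! := by
  have h : ((∑ m ∈ Finset.range (n + 1),
      m ! * (n - m)‼ * (cherrySwapCount s m * cherrySwapCount t m) : ℕ) : ℝ) ≤
      intertwineCount s t := Nat.cast_le.2 (le_intertwineCount hs ht)
  rw [Nat.cast_sum, sum_range_eq_sum_of_even] at h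
  · rw [cherryWeight, ← Finset.sum_div]
    refine div_le_div_of_nonneg_right (le_trans (le_of_eq ?_) h) (by positivity)
    refine Finset.sum_congr rfl fun q hq => ?_
    have hq' : 2 * q ≤ n := by
      rw [Finset.mem_range] at hq
      omega
    rw [Nat.cast_mul, doubleFactorial_weight hq, cherrySwapCount_eq hs hq',
      cherrySwapCount_eq ht hq', Nat.cast_mul]
  · intro m hm
    have h0 : cherrySwapCount s m = 0 := Nat.le_zero.1
      ((cherrySwapCount_le_autCount s m).trans_eq (autCount_eq_zero (by rwa [hs])))
    simp [h0]

theorem intertwineCount_le_sum {s t : BinaryTree Unit} {n : ℕ} (hs : s.numLeaves = n) :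
    (intertwineCount s t / n ! : ℝ) ≤ ∑ q ∈ Finset.range (n / 2 + 1),
      ((n - 2 * q)! * (2 ^ q * q !) : ℝ) *
        (autCount s (n - 2 * q) * autCount t (n - 2 * q)) / n ! := by
  have h : (intertwineCount s t : ℝ) ≤ ((∑ m ∈ Finset.range (n + 1),
      m ! * (n - m)‼ * (autCount s m * autCount t m) : ℕ) : ℝ) :=
    Nat.cast_le.2 (intertwineCount_le hs)
  rw [Nat.cast_sum, sum_range_eq_sum_of_even] at h
  · rw [← Finset.sum_div]
    refine div_le_div_of_nonneg_right (h.trans (le_of_eq ?_)) (by positivity)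
    refine Finset.sum_congr rfl fun q hq => ?_
    rw [Nat.cast_mul, doubleFactorial_weight hq, Nat.cast_mul]
  · intro m hm
    simp [autCount_eq_zero (t := s) (m := m) (by rwa [hs])]

/-! ### Automorphisms compared with cherry swaps on average. -/

theorem catalan_monotone : Monotone catalan := by
  refine monotone_nat_of_le_succ fun n => ?_
  rw [catalan_succ']
  have := Finset.single_le_sum (f := fun p : ℕ × ℕ => catalan p.1 * catalan p.2)
    (fun _ _ => Nat.zero_le _) (Finset.HasAntidiagonal.mem_antidiagonal.2 (zero_add n) :
      ((0, n) : ℕ × ℕ) ∈ Finset.HasAntidiagonal.antidiagonal n)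
  simpa using this

/-- Collapsing `q` marked cherries to leaves gives a plane tree with `n + 1 - q` leaves, `q` of them
marked. The cases `q = 1, 2` also yield the first two moments of the number of cherries. -/
theorem sum_cherries_choose {n q : ℕ} (hq : 2 * q ≤ n + 1) :
    ∑ t ∈ treesOfNumNodesEq n, ((cherries t).choose q : ℝ) =
      catalan (n - q) * (n + 1 - q).choose q := by
  have h := coeff_leafSum_cherry (n + 1 - 2 * q) q (by omega)
  rw [Nat.sub_add_cancel hq, coeff_leafSum_cherrySwapPoly,
    show n + 1 - 2 * q + q - 1 = n - q by omega, show n + 1 - 2 * q + q = n + 1 - q by omega,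
    show n + 1 - 2 * q = n + 1 - q - q by omega, Nat.choose_symm (by omega)] at h
  rw [← h]
  refine Finset.sum_congr rfl fun t ht => ?_
  rw [show n + 1 - q - q = n + 1 - 2 * q by omega, cherrySwapCount_eq _ hq]
  rw [BinaryTree.numLeaves_eq_numNodes_succ, BinaryTree.mem_treesOfNumNodesEq.1 ht]

/-- This is the source of the saving of order `1 / n`: `(m + q - 1).choose m` is `q / (m + q)` times
`(m + q).choose m`, and `m + 2q ≤ 2(m + q)`. -/
theorem mul_choose_le {m q j : ℕ} (hj : j < q) :
    (m + 2 * q : ℝ) * (m + j).choose m ≤ 2 * q * (m + q).choose m := by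
  obtain ⟨p, rfl⟩ : ∃ p, q = p + 1 := ⟨q - 1, by omega⟩
  have h1 : (m + j).choose m ≤ (m + p).choose m := Nat.choose_le_choose m (by omega)
  have h2 : (m + p + 1) * (m + p).choose m = (p + 1) * (m + p + 1).choose m := by
    have := Nat.add_one_mul_choose_eq (m + p) p
    rw [Nat.choose_symm_of_eq_add (show m + p = p + m by ring),
      Nat.choose_symm_of_eq_add (show m + p + 1 = (p + 1) + m by ring)] at this
    rw [this]
    ring
  have h3 : (m + 2 * (p + 1)) * (m + j).choose m ≤ 2 * (p + 1) * (m + (p + 1)).choose m := by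
    calc (m + 2 * (p + 1)) * (m + j).choose m ≤ (2 * (m + p + 1)) * (m + p).choose m :=
          Nat.mul_le_mul (by omega) h1
      _ = 2 * ((m + p + 1) * (m + p).choose m) := by ring
      _ = 2 * (p + 1) * (m + (p + 1)).choose m := by
        rw [h2]
        ring_nf
  exact_mod_cast h3

/-- In `coeff_leafSum` the term `j = q` is the count of cherry swaps. Each of the `q` terms with `j
< q` is at most `2q / (n + 1)` times that, up to the factor `64 ^ q` that bounds the exchanged
pairs. -/
theorem sum_autCount_le {n q : ℕ} (hq : 2 * q ≤ n + 1) :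
    ∑ t ∈ treesOfNumNodesEq n, (autCount t (n + 1 - 2 * q) : ℝ) ≤
      (catalan (n - q) * (n + 1 - q).choose q) * (1 + 2 * q ^ 2 * 64 ^ q / (n + 1)) := by
  obtain ⟨m, hm⟩ := Nat.exists_eq_add_of_le' hq
  have h := coeff_leafSum autPoly_nil (c := swapWeight) (fun l r => autPoly_node () l r) m q
    (by omega)
  have hn : (n + 1 : ℝ) = m + 2 * q := by exact_mod_cast hm
  rw [← hm, coeff_leafSum_autPoly, Finset.sum_range_succ] at h
  rw [show n + 1 - 2 * q = m by omega, h, show n - q = m + q - 1 by omega,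
    show n + 1 - q = m + q by omega, hn]
  have h0 : PowerSeries.coeff (2 * (q - q)) (PowerSeries.mk (pairSum swapWeight) ^ q) = 1 := by
    have : pairSum swapWeight 0 = 1 := by
      simp only [pairSum, Finset.Nat.antidiagonal_zero, Finset.sum_singleton,
        BinaryTree.treesOfNumNodesEq_zero, swapWeight]
      have : Fintype.card (TreeIso .nil .nil) = 1 := rfl
      rw [this]
      norm_num
    simp [this]
  rw [h0, mul_one, Nat.choose_symm_of_eq_add (rfl : m + q = m + q), mul_one_add, add_comm]
  refine add_le_add_right ?_ _
  have hpos : (0 : ℝ) < m + 2 * q := by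
    rw [← hn]
    positivity
  calc ∑ j ∈ Finset.range q, (catalan (m + j - 1) : ℝ) * ((m + j).choose m *
        PowerSeries.coeff (2 * (q - j)) (PowerSeries.mk (pairSum swapWeight) ^ j))
      ≤ ∑ j ∈ Finset.range q, (catalan (m + q - 1) : ℝ) *
        ((2 * q * (m + q).choose m / (m + 2 * q)) * 64 ^ q) := by
        refine Finset.sum_le_sum fun j hj => ?_
        rw [Finset.mem_range] at hj
        refine mul_le_mul ?_ (mul_le_mul ?_ ?_ (coeff_pairSum_pow_nonneg _ _) ?_) ?_ ?_
        · exact_mod_cast catalan_monotone (by omega)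
        · rw [le_div_iff₀ hpos, mul_comm]
          exact mul_choose_le hj
        · refine (coeff_pairSum_pow_le _ _).trans ?_
          calc (2 : ℝ) ^ j * 8 ^ (2 * (q - j)) ≤ 64 ^ j * 64 ^ (q - j) := by
                rw [pow_mul]
                norm_num
                exact pow_le_pow_left₀ (by norm_num) (by norm_num) _
            _ = 64 ^ q := by rw [← pow_add, Nat.add_sub_cancel' hj.le]
        · positivity
        · exact mul_nonneg (by positivity) (coeff_pairSum_pow_nonneg _ _)
        · positivity
    _ = _ := by
        rw [Finset.sum_const, Finset.card_range, nsmul_eq_mul,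
          Nat.choose_symm_of_eq_add (rfl : m + q = m + q)]
        ring

/-- One binomial coefficient combines with `q! (n - 2q)!` to `(n - q)!`. The other, times `q!`, is a
falling factorial of `n - q` and hence at most that of `n`, which is `n! / (n - q)!`. -/
theorem weight_mul_sq_le {n q : ℕ} (hq : 2 * q ≤ n) :
    ((n - 2 * q)! * (2 ^ q * q !) : ℝ) * ((n - q).choose q) ^ 2 / n ! ≤ 2 ^ q / q ! := by
  have h1 := Nat.choose_mul_factorial_mul_factorial (show q ≤ n - q by omega)
  rw [show n - q - q = n - 2 * q by omega] at h1
  have h2 : (n - q)! * (n.descFactorial q) = n ! :=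
    Nat.factorial_mul_descFactorial (by omega)
  have h3 : (n - q).descFactorial q ≤ n.descFactorial q :=
    Nat.descFactorial_le q (by omega)
  have h4 : q ! * (n - q).choose q = (n - q).descFactorial q :=
    (Nat.descFactorial_eq_factorial_mul_choose _ _).symm
  have h5 : (n - 2 * q)! * q ! * (n - q).choose q ^ 2 * q ! ≤ n ! := by
    calc (n - 2 * q)! * q ! * (n - q).choose q ^ 2 * q !
        = ((n - q).choose q * q ! * (n - 2 * q)!) * (q ! * (n - q).choose q) := by ring
      _ ≤ (n - q)! * n.descFactorial q := by
        rw [h1, h4]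
        exact Nat.mul_le_mul_left _ h3
      _ = n ! := h2
  have h6 : ((n - 2 * q)! * q ! * (n - q).choose q ^ 2 * q ! : ℝ) ≤ n ! := by exact_mod_cast h5
  rw [div_le_div_iff₀ (by positivity) (by positivity)]
  calc ((n - 2 * q)! * (2 ^ q * q !) : ℝ) * ((n - q).choose q) ^ 2 * q !
      = 2 ^ q * ((n - 2 * q)! * q ! * (n - q).choose q ^ 2 * q ! : ℝ) := by ring
    _ ≤ 2 ^ q * n ! := mul_le_mul_of_nonneg_left h6 (by positivity)

/-- On average, the intertwining triples are made of products of cherry swaps up to a proportion of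
order `1 / n`. -/
theorem sum_intertwineCount_sub_cherryWeight_le (n : ℕ) :
    ∑ s ∈ treesOfNumNodesEq n, ∑ t ∈ treesOfNumNodesEq n,
      ((intertwineCount s t / (n + 1)! : ℝ) - cherryWeight (n + 1) (cherries s) (cherries t)) ≤
      catalan n ^ 2 * (6 * Real.exp 65536 / (n + 1)) := by
  have hleaves : ∀ s ∈ treesOfNumNodesEq n, s.numLeaves = n + 1 := fun s hs => by
    rw [BinaryTree.numLeaves_eq_numNodes_succ, BinaryTree.mem_treesOfNumNodesEq.1 hs]
  let w : ℕ → ℝ := fun q => ((n + 1 - 2 * q)! * (2 ^ q * q !) : ℝ) / (n + 1)!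
  have h1 : ∀ s ∈ treesOfNumNodesEq n, ∀ t ∈ treesOfNumNodesEq n,
      ((intertwineCount s t / (n + 1)! : ℝ) - cherryWeight (n + 1) (cherries s) (cherries t)) ≤
      ∑ q ∈ Finset.range ((n + 1) / 2 + 1), w q * ((autCount s (n + 1 - 2 * q) : ℝ) *
        autCount t (n + 1 - 2 * q) - (cherries s).choose q * (cherries t).choose q) := by
    intro s hs t ht
    refine (sub_le_sub_right (intertwineCount_le_sum (hleaves s hs)) _).trans (le_of_eq ?_)
    rw [cherryWeight, ← Finset.sum_sub_distrib]
    refine Finset.sum_congr rfl fun q _ => ?_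
    simp only [w]
    ring
  refine (Finset.sum_le_sum fun s hs => Finset.sum_le_sum fun t ht => h1 s hs t ht).trans ?_
  -- For each `q` the two trees separate, so only first moments over single trees are needed.
  have h2 : ∑ s ∈ treesOfNumNodesEq n, ∑ t ∈ treesOfNumNodesEq n,
      ∑ q ∈ Finset.range ((n + 1) / 2 + 1), w q * ((autCount s (n + 1 - 2 * q) : ℝ) *
        autCount t (n + 1 - 2 * q) - (cherries s).choose q * (cherries t).choose q) =
      ∑ q ∈ Finset.range ((n + 1) / 2 + 1),
        w q * ((∑ s ∈ treesOfNumNodesEq n, (autCount s (n + 1 - 2 * q) : ℝ)) ^ 2 -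
          (∑ s ∈ treesOfNumNodesEq n, ((cherries s).choose q : ℝ)) ^ 2) := by
    rw [Finset.sum_congr rfl fun s _ => Finset.sum_comm, Finset.sum_comm]
    refine Finset.sum_congr rfl fun q _ => ?_
    rw [pow_two, pow_two, Finset.sum_mul_sum, Finset.sum_mul_sum, ← Finset.sum_sub_distrib,
      Finset.mul_sum]
    refine Finset.sum_congr rfl fun s _ => ?_
    rw [← Finset.sum_sub_distrib, Finset.mul_sum]
  rw [h2]
  have h3 : ∀ q ∈ Finset.range ((n + 1) / 2 + 1),
      w q * ((∑ s ∈ treesOfNumNodesEq n, (autCount s (n + 1 - 2 * q) : ℝ)) ^ 2 -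
          (∑ s ∈ treesOfNumNodesEq n, ((cherries s).choose q : ℝ)) ^ 2) ≤
        catalan n ^ 2 * (6 / (n + 1)) * (65536 ^ q / q !) := by
    intro q hq
    have hq : 2 * q ≤ n + 1 := by
      rw [Finset.mem_range] at hq
      omega
    have hR := sum_autCount_le hq
    have hR0 : (0 : ℝ) ≤ ∑ s ∈ treesOfNumNodesEq n, (autCount s (n + 1 - 2 * q) : ℝ) :=
      Finset.sum_nonneg fun _ _ => Nat.cast_nonneg _
    rw [sum_cherries_choose hq]
    have hw : 0 ≤ w q := by positivity
    set A : ℝ := catalan (n - q) * (n + 1 - q).choose q with hA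
    have hA0 : 0 ≤ A := by positivity
    set ε : ℝ := 2 * q ^ 2 * 64 ^ q / (n + 1) with hε
    have hε0 : 0 ≤ ε := by positivity
    have hq2 : (q : ℝ) ≤ 2 ^ q := by exact_mod_cast Nat.lt_two_pow_self.le
    -- In `ε * (2 + ε)` the first factor must retain the `1 / n`. The second only needs a bound
    -- uniform in `n`, which `2 * q ≤ n + 1` provides.
    have hε1 : ε ≤ 2 * 256 ^ q / (n + 1) := by
      rw [hε]
      refine div_le_div_of_nonneg_right ?_ (by positivity)
      calc (2 : ℝ) * q ^ 2 * 64 ^ q ≤ 2 * (2 ^ q) ^ 2 * 64 ^ q := by gcongr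
        _ = 2 * 256 ^ q := by
          rw [← pow_mul, mul_comm q 2, pow_mul, mul_assoc, ← mul_pow]
          norm_num
    have hε2 : ε ≤ 128 ^ q := by
      rw [hε, div_le_iff₀ (by positivity)]
      have : (2 * q : ℝ) ≤ n + 1 := by exact_mod_cast hq
      calc (2 : ℝ) * q ^ 2 * 64 ^ q = q * 64 ^ q * (2 * q) := by ring
        _ ≤ 2 ^ q * 64 ^ q * (n + 1) := by gcongr
        _ = 128 ^ q * (n + 1) := by
          rw [← mul_pow]
          norm_num
    have hwA : w q * A ^ 2 ≤ (catalan n : ℝ) ^ 2 * (2 ^ q / q !) := by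
      have h5 := weight_mul_sq_le hq
      have h6 : (catalan (n - q) : ℝ) ≤ catalan n := by
        exact_mod_cast catalan_monotone (by omega)
      calc w q * A ^ 2 = (catalan (n - q) : ℝ) ^ 2 * (((n + 1 - 2 * q)! * (2 ^ q * q !) : ℝ) *
            ((n + 1 - q).choose q) ^ 2 / (n + 1)!) := by
            simp only [w, hA]
            ring
        _ ≤ (catalan n : ℝ) ^ 2 * (2 ^ q / q !) := by gcongr
    calc w q * ((∑ s ∈ treesOfNumNodesEq n, (autCount s (n + 1 - 2 * q) : ℝ)) ^ 2 - A ^ 2)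
        ≤ w q * ((A * (1 + ε)) ^ 2 - A ^ 2) := by gcongr
      _ = (w q * A ^ 2) * (ε * (2 + ε)) := by ring
      _ ≤ (catalan n ^ 2 * (2 ^ q / q !)) * ((2 * 256 ^ q / (n + 1)) * (3 * 128 ^ q)) := by
        have h1 : (1 : ℝ) ≤ 128 ^ q := one_le_pow₀ (by norm_num)
        gcongr
        linarith
      _ = catalan n ^ 2 * (6 / (n + 1)) * ((2 ^ q * 256 ^ q * 128 ^ q) / q !) := by ring
      -- The base is `2 * 256 * 128`; the factorial makes the sum over `q` at most `exp 65536`.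
      _ = catalan n ^ 2 * (6 / (n + 1)) * (65536 ^ q / q !) := by
        rw [← mul_pow, ← mul_pow]
        norm_num
  refine (Finset.sum_le_sum h3).trans ?_
  rw [← Finset.mul_sum]
  calc catalan n ^ 2 * (6 / ((n : ℝ) + 1)) * ∑ q ∈ Finset.range ((n + 1) / 2 + 1),
        ((65536 : ℝ) ^ q / q !)
      ≤ catalan n ^ 2 * (6 / ((n : ℝ) + 1)) * Real.exp 65536 := by
        refine mul_le_mul_of_nonneg_left ?_ (by positivity)
        exact Real.sum_le_exp_of_nonneg (by norm_num) _
    _ = _ := by ring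

/-! ### Size and limit of the cherry weight. -/

/-- The ratio of `i`-th consecutive terms of `cherryWeight`, up to the factor `i + 1`. -/
noncomputable def cherryRatio (n c d i : ℕ) : ℝ :=
  2 * ((c - i : ℕ) * (d - i : ℕ)) / ((n - 2 * i : ℕ) * (n - 2 * i - 1 : ℕ))

section

variable {n c d : ℕ}

theorem cherryRatio_nonneg (i : ℕ) : 0 ≤ cherryRatio n c d i := by
  unfold cherryRatio
  positivity

theorem cherryRatio_eq_zero {i : ℕ} (h : c ≤ i ∨ d ≤ i) : cherryRatio n c d i = 0 := by
  unfold cherryRatio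
  rcases h with h | h <;> simp [Nat.sub_eq_zero_of_le h]

theorem cherryRatio_eq (hc : 2 * c ≤ n) {i : ℕ} (hi : i < c) (hi' : i < d) :
    cherryRatio n c d i =
      2 * ((c - i : ℝ) * (d - i)) / ((n - 2 * i : ℝ) * (n - 2 * i - 1)) := by
  rw [cherryRatio, Nat.cast_sub hi.le, Nat.cast_sub hi'.le,
    Nat.cast_sub (show 1 ≤ n - 2 * i by omega), Nat.cast_sub (show 2 * i ≤ n by omega)]
  push_cast
  rfl

/-- When the ratio is not zero, `2(c - i)` and `2(d - i)` are at most `n - 2i`, so the numerator is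
at most `(n - 2i)² / 2`. This is below the denominator because `n - 2i ≥ 2`. -/
theorem cherryRatio_le_one (hc : 2 * c ≤ n) (hd : 2 * d ≤ n) (i : ℕ) :
    cherryRatio n c d i ≤ 1 := by
  by_cases hi : i < c ∧ i < d
  · rw [cherryRatio_eq hc hi.1 hi.2]
    have hc' : (2 * c : ℝ) ≤ n := by exact_mod_cast hc
    have hd' : (2 * d : ℝ) ≤ n := by exact_mod_cast hd
    have h1 : (i + 1 : ℝ) ≤ c := by exact_mod_cast hi.1
    have h2 : (i + 1 : ℝ) ≤ d := by exact_mod_cast hi.2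
    rw [div_le_one (mul_pos (by linarith) (by linarith))]
    nlinarith [mul_le_mul (show (2 : ℝ) * (c - i) ≤ n - 2 * i by linarith)
      (show (2 : ℝ) * (d - i) ≤ n - 2 * i by linarith) (by linarith) (by linarith)]
  · rw [cherryRatio_eq_zero (by omega)]
    norm_num

/-- For `4(i + 1) ≤ n` the denominators are at least `n / 2` and the two factors are compared
separately. For larger `i` the bound exceeds `1` while both quantities lie in `[0, 1]`. If `i`
reaches `c` or `d`, the ratio is zero and the product is at most `i / n`. -/
theorem abs_cherryRatio_sub_le (hc : 2 * c ≤ n) (hd : 2 * d ≤ n) (hn : 0 < n) (i : ℕ) :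
    |cherryRatio n c d i - 2 * ((c / n : ℝ) * (d / n))| ≤ 6 * (i + 1) / n := by
  have hn' : (0 : ℝ) < n := by exact_mod_cast hn
  have hc' : (2 * c : ℝ) ≤ n := by exact_mod_cast hc
  have hd' : (2 * d : ℝ) ≤ n := by exact_mod_cast hd
  have ha0 : (0 : ℝ) ≤ c / n := by positivity
  have hb0 : (0 : ℝ) ≤ d / n := by positivity
  have ha : (c / n : ℝ) ≤ 1 / 2 := by rw [div_le_iff₀ hn']; linarith
  have hb : (d / n : ℝ) ≤ 1 / 2 := by rw [div_le_iff₀ hn']; linarith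
  by_cases hi : i < c ∧ i < d
  · rcases lt_or_ge n (4 * (i + 1)) with h4 | h4
    · have h1 := cherryRatio_nonneg (n := n) (c := c) (d := d) i
      have h2 := cherryRatio_le_one hc hd i
      have h3 : (1 : ℝ) ≤ 6 * (i + 1) / n := by
        rw [le_div_iff₀ hn']
        have : (n : ℝ) < 4 * (i + 1) := by exact_mod_cast h4
        linarith
      refine le_trans (abs_le.2 ⟨?_, ?_⟩) h3 <;> nlinarith
    · rw [cherryRatio_eq hc hi.1 hi.2]
      have h4' : (4 * (i + 1) : ℝ) ≤ n := by exact_mod_cast h4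
      have h1 : (i + 1 : ℝ) ≤ c := by exact_mod_cast hi.1
      have h2 : (i + 1 : ℝ) ≤ d := by exact_mod_cast hi.2
      have hi0 : (0 : ℝ) ≤ i := Nat.cast_nonneg i
      have hD : (n : ℝ) / 2 ≤ n - 2 * i - 1 := by linarith
      have hD1 : (0 : ℝ) < n - 2 * i - 1 := by linarith
      have hD2 : (0 : ℝ) < n - 2 * i := by linarith
      set u : ℝ := (c - i) / (n - 2 * i) with hu
      set v : ℝ := (d - i) / (n - 2 * i - 1) with hv
      have huv : 2 * ((c - i : ℝ) * (d - i)) / ((n - 2 * i : ℝ) * (n - 2 * i - 1)) =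
          2 * (u * v) := by
        rw [hu, hv, div_mul_div_comm, mul_div_assoc]
      have hua : |u - c / n| ≤ 2 * i / n := by
        have : u - c / n = -(i * (n - 2 * c)) / ((n - 2 * i) * n) := by
          rw [hu, div_sub_div _ _ hD2.ne' hn'.ne']
          congr 1
          ring
        rw [this, abs_div, abs_neg, abs_of_nonneg (mul_nonneg hi0 (by linarith)),
          abs_of_pos (by positivity), div_le_div_iff₀ (by positivity) hn']
        have : (i : ℝ) * (n - 2 * c) ≤ 2 * i * (n - 2 * i) := by nlinarith
        nlinarith
      have hvb : |v - d / n| ≤ 2 * (i + 1) / n := by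
        have : v - d / n = (d - i * (n - 2 * d)) / ((n - 2 * i - 1) * n) := by
          rw [hv, div_sub_div _ _ hD1.ne' hn'.ne']
          congr 1
          ring
        have h5 : |(d - i * (n - 2 * d) : ℝ)| ≤ (i + 1) * n := by
          rw [abs_le]
          constructor <;> nlinarith
        rw [this, abs_div, abs_of_pos (show (0 : ℝ) < (n - 2 * i - 1) * n by positivity),
          div_le_div_iff₀ (by positivity) hn']
        have : (i + 1 : ℝ) * n ≤ 2 * (i + 1) * (n - 2 * i - 1) := by nlinarith
        nlinarith
      have hv0 : 0 ≤ v := div_nonneg (by linarith) hD1.le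
      have hv1 : v ≤ 1 := by
        rw [hv, div_le_one hD1]
        linarith
      rw [huv]
      have : 2 * (u * v) - 2 * ((c / n : ℝ) * (d / n)) =
          2 * ((u - c / n) * v) + 2 * (c / n * (v - d / n)) := by ring
      rw [this]
      calc |2 * ((u - c / n) * v) + 2 * (c / n * (v - d / n))|
          ≤ |2 * ((u - c / n) * v)| + |2 * (c / n * (v - d / n))| := abs_add_le _ _
        _ = 2 * (|u - c / n| * v) + 2 * (c / n * |v - d / n|) := by
          rw [abs_mul, abs_mul, abs_mul, abs_mul, abs_of_nonneg hv0, abs_of_nonneg ha0,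
            abs_of_pos (show (0 : ℝ) < 2 by norm_num)]
        _ ≤ 2 * (2 * i / n * 1) + 2 * (1 / 2 * (2 * (i + 1) / n)) := by
          gcongr
        _ ≤ 6 * (i + 1) / n := by
          rw [show 2 * (2 * i / n * 1) + 2 * (1 / 2 * (2 * (i + 1) / n)) =
            (4 * i + 2 * (i + 1) : ℝ) / n by ring]
          gcongr
          linarith
  · rw [cherryRatio_eq_zero (by omega), zero_sub, abs_neg, abs_of_nonneg (by positivity)]
    have hi0 : (0 : ℝ) ≤ i / n := by positivity
    have h6 : (6 * (i + 1) / n : ℝ) = 6 * (i / n) + 6 / n := by ring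
    have h7 : (0 : ℝ) ≤ 6 / n := by positivity
    have : (c : ℝ) ≤ i ∨ (d : ℝ) ≤ i := by
      rcases not_and_or.1 hi with h | h
      · exact .inl (by exact_mod_cast not_lt.1 h)
      · exact .inr (by exact_mod_cast not_lt.1 h)
    rcases this with h | h
    · have : (c / n : ℝ) ≤ i / n := by gcongr
      nlinarith
    · have : (d / n : ℝ) ≤ i / n := by gcongr
      nlinarith

theorem cherryWeight_term {q : ℕ} (hq : 2 * q ≤ n) :
    ((n - 2 * q)! * (2 ^ q * q !) : ℝ) * (c.choose q * d.choose q) / n ! =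
      (∏ i ∈ Finset.range q, cherryRatio n c d i) / q ! := by
  induction q with
  | zero => simp [Nat.factorial_ne_zero]
  | succ q ih =>
    have ih := ih (by omega)
    have hf : (n - 2 * q)! = (n - 2 * q) * ((n - 2 * q - 1) * (n - 2 * (q + 1))!) := by
      obtain ⟨k, hk⟩ := Nat.exists_eq_add_of_le' hq
      rw [show n - 2 * q = k + 2 by omega, show n - 2 * (q + 1) = k by omega,
        Nat.factorial_succ, Nat.factorial_succ]
      rfl
    have h1 := Nat.choose_succ_right_eq c q
    have h2 := Nat.choose_succ_right_eq d q
    have h1' : (c.choose (q + 1) : ℝ) = c.choose q * (c - q : ℕ) / (q + 1) := by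
      rw [eq_div_iff (by positivity)]
      exact_mod_cast h1
    have h2' : (d.choose (q + 1) : ℝ) = d.choose q * (d - q : ℕ) / (q + 1) := by
      rw [eq_div_iff (by positivity)]
      exact_mod_cast h2
    have hp1 : ((n - 2 * q : ℕ) : ℝ) ≠ 0 := by
      rw [Nat.cast_ne_zero]
      omega
    have hp2 : ((n - 2 * q - 1 : ℕ) : ℝ) ≠ 0 := by
      rw [Nat.cast_ne_zero]
      omega
    have hf' : ((n - 2 * (q + 1))! : ℝ) =
        (n - 2 * q)! / ((n - 2 * q : ℕ) * (n - 2 * q - 1 : ℕ)) := by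
      rw [hf]
      push_cast
      field_simp
    have hq' : ((q + 1)! : ℝ) = (q + 1) * q ! := by
      rw [Nat.factorial_succ]
      push_cast
      rfl
    have : (∏ i ∈ Finset.range q, cherryRatio n c d i) * cherryRatio n c d q / ((q + 1) * q !) =
        (∏ i ∈ Finset.range q, cherryRatio n c d i) / q ! * (cherryRatio n c d q / (q + 1)) := by
      field_simp
    rw [Finset.prod_range_succ, hq', this, ← ih, hf', h1', h2', cherryRatio]
    field_simp
    ring

theorem prod_cherryRatio_eq_zero (hc : 2 * c ≤ n) {q : ℕ} (hq : n < 2 * q) :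
    ∏ i ∈ Finset.range q, cherryRatio n c d i = 0 :=
  Finset.prod_eq_zero (Finset.mem_range.2 (show c < q by omega))
    (cherryRatio_eq_zero (.inl le_rfl))

theorem cherryWeight_eq : cherryWeight n c d =
    ∑ q ∈ Finset.range (n / 2 + 1), (∏ i ∈ Finset.range q, cherryRatio n c d i) / q ! :=
  Finset.sum_congr rfl fun q hq => cherryWeight_term (by rw [Finset.mem_range] at hq; omega)

theorem one_le_cherryWeight : 1 ≤ cherryWeight n c d := by
  rw [cherryWeight_eq, Finset.sum_range_succ']
  simp only [Finset.range_zero, Finset.prod_empty, Nat.factorial_zero, Nat.cast_one, div_one]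
  refine le_add_of_nonneg_left (Finset.sum_nonneg fun q _ => div_nonneg
    (Finset.prod_nonneg fun i _ => cherryRatio_nonneg i) (by positivity))

theorem cherryWeight_le (hc : 2 * c ≤ n) (hd : 2 * d ≤ n) :
    cherryWeight n c d ≤ Real.exp 1 := by
  rw [cherryWeight_eq]
  refine le_trans (Finset.sum_le_sum fun q _ => ?_)
    (Real.sum_le_exp_of_nonneg zero_le_one (n / 2 + 1))
  rw [one_pow]
  exact div_le_div_of_nonneg_right (Finset.prod_le_one (fun i _ => cherryRatio_nonneg i)
    fun i _ => cherryRatio_le_one hc hd i) (by positivity)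

theorem abs_prod_sub_pow_le {y : ℕ → ℝ} {x : ℝ} (hy0 : ∀ i, 0 ≤ y i) (hy1 : ∀ i, y i ≤ 1)
    (hx0 : 0 ≤ x) (hx1 : x ≤ 1) (q : ℕ) :
    |∏ i ∈ Finset.range q, y i - x ^ q| ≤ ∑ i ∈ Finset.range q, |y i - x| := by
  induction q with
  | zero => simp
  | succ q ih =>
    rw [Finset.prod_range_succ, Finset.sum_range_succ, pow_succ]
    have : (∏ i ∈ Finset.range q, y i) * y q - x ^ q * x =
        (∏ i ∈ Finset.range q, y i - x ^ q) * y q + x ^ q * (y q - x) := by ring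
    rw [this]
    refine (abs_add_le _ _).trans (add_le_add ?_ ?_)
    · rw [abs_mul, abs_of_nonneg (hy0 q)]
      exact (mul_le_of_le_one_right (abs_nonneg _) (hy1 q)).trans ih
    · rw [abs_mul, abs_of_nonneg (pow_nonneg hx0 q)]
      exact mul_le_of_le_one_left (abs_nonneg _) (pow_le_one₀ hx0 hx1)

/-- Termwise comparison with the exponential series at `1 / 8 = 2 * (1 / 4)²`, the value of the
ratio when both trees have about `n / 4` cherries. The numerators of the `q`-th terms differ by at
most `q * (6q / n + δ)`, which `4 ^ q * (6 / n + δ)` dominates. -/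
theorem abs_cherryWeight_sub_le (hc : 2 * c ≤ n) (hd : 2 * d ≤ n) (hn : 0 < n) :
    |cherryWeight n c d - Real.exp (1 / 8)| ≤
      (6 / n + (|(c / n : ℝ) - 1 / 4| + |(d / n : ℝ) - 1 / 4|)) * Real.exp 4 := by
  have hn' : (0 : ℝ) < n := by exact_mod_cast hn
  have hc' : (2 * c : ℝ) ≤ n := by exact_mod_cast hc
  have hd' : (2 * d : ℝ) ≤ n := by exact_mod_cast hd
  have hb0 : (0 : ℝ) ≤ d / n := by positivity
  have hb : (d / n : ℝ) ≤ 1 / 2 := by rw [div_le_iff₀ hn']; linarith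
  set δ : ℝ := |(c / n : ℝ) - 1 / 4| + |(d / n : ℝ) - 1 / 4| with hδ
  have hδ0 : 0 ≤ δ := by positivity
  have hδ1 : |2 * ((c / n : ℝ) * (d / n)) - 1 / 8| ≤ δ := by
    have : 2 * ((c / n : ℝ) * (d / n)) - 1 / 8 =
        (2 * (d / n)) * (c / n - 1 / 4) + 1 / 2 * (d / n - 1 / 4) := by ring
    rw [this]
    refine (abs_add_le _ _).trans ?_
    rw [abs_mul (2 * (d / n : ℝ)), abs_mul (1 / 2 : ℝ),
      abs_of_nonneg (by positivity : (0 : ℝ) ≤ 2 * (d / n)),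
      abs_of_pos (by norm_num : (0 : ℝ) < 1 / 2), hδ]
    have h1 := abs_nonneg ((c / n : ℝ) - 1 / 4)
    have h2 := abs_nonneg ((d / n : ℝ) - 1 / 4)
    nlinarith
  set x : ℕ → ℝ := fun q => ∏ i ∈ Finset.range q, cherryRatio n c d i with hx
  -- The finite sum is a full series: beyond `q = n / 2` each product contains the vanishing ratio
  -- at `i = c`.
  have hsum : HasSum (fun q => x q / q !) (cherryWeight n c d) := by
    rw [cherryWeight_eq]
    refine hasSum_sum_of_ne_finset_zero fun q hq => ?_
    rw [Finset.mem_range] at hq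
    rw [hx]
    simp only
    rw [prod_cherryRatio_eq_zero hc (by omega), zero_div]
  have hexp : ∀ y : ℝ, HasSum (fun q : ℕ => y ^ q / q !) (Real.exp y) := fun y => by
    rw [Real.exp_eq_exp_ℝ]
    exact NormedSpace.expSeries_div_hasSum_exp y
  have hdiff := hsum.sub (hexp (1 / 8))
  have hbound := (hexp 4).mul_left (6 / n + δ)
  have hterm : ∀ q : ℕ, ‖x q / (q ! : ℝ) - (1 / 8) ^ q / (q ! : ℝ)‖ ≤ (6 / n + δ) * (4 ^ q / q !) := by
    intro q
    rw [← sub_div, norm_div, Real.norm_eq_abs, Real.norm_natCast, ← mul_div_assoc]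
    refine div_le_div_of_nonneg_right ?_ (by positivity)
    refine (abs_prod_sub_pow_le (fun i => cherryRatio_nonneg i)
      (fun i => cherryRatio_le_one hc hd i) (by norm_num) (by norm_num) q).trans ?_
    have h1 : ∀ i ∈ Finset.range q, |cherryRatio n c d i - 1 / 8| ≤ 6 * q / n + δ := by
      intro i hi
      have hiq : (i + 1 : ℝ) ≤ q := by exact_mod_cast Finset.mem_range.1 hi
      calc |cherryRatio n c d i - 1 / 8|
          ≤ |cherryRatio n c d i - 2 * ((c / n : ℝ) * (d / n))| +
            |2 * ((c / n : ℝ) * (d / n)) - 1 / 8| := abs_sub_le _ _ _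
        _ ≤ 6 * (i + 1) / n + δ := add_le_add (abs_cherryRatio_sub_le hc hd hn i) hδ1
        _ ≤ 6 * q / n + δ := by gcongr
    refine (Finset.sum_le_sum h1).trans ?_
    rw [Finset.sum_const, Finset.card_range, nsmul_eq_mul]
    have hq2 : (q : ℝ) ≤ 2 ^ q := by exact_mod_cast Nat.lt_two_pow_self.le
    have hq1 : (1 : ℝ) ≤ 2 ^ q := one_le_pow₀ (by norm_num)
    have h4 : (4 : ℝ) ^ q = 2 ^ q * 2 ^ q := by
      rw [← mul_pow]
      norm_num
    have h5 : (q : ℝ) * q ≤ 4 ^ q := by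
      rw [h4]
      gcongr
    have h6 : (q : ℝ) ≤ 4 ^ q := by
      rw [h4]
      nlinarith
    calc (q : ℝ) * (6 * q / n + δ) = 6 / n * (q * q) + δ * q := by ring
      _ ≤ 6 / n * 4 ^ q + δ * 4 ^ q := by gcongr
      _ = (6 / n + δ) * 4 ^ q := by ring
  rw [← hdiff.tsum_eq, ← hbound.tsum_eq, ← Real.norm_eq_abs]
  exact tsum_of_norm_bounded hbound.summable.hasSum hterm

end

/-! ### Concentration of the number of cherries. -/

theorem add_two_mul_catalan_succ (n : ℕ) :
    (n + 2 : ℝ) * catalan (n + 1) = 2 * (2 * n + 1) * catalan n := by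
  have h1 := succ_mul_catalan_eq_centralBinom n
  have h2 := succ_mul_catalan_eq_centralBinom (n + 1)
  have h3 := Nat.succ_mul_centralBinom_succ n
  rw [← h1, ← h2] at h3
  have h4 : (n + 1) * ((n + 2) * catalan (n + 1)) = (n + 1) * (2 * (2 * n + 1) * catalan n) := by
    linarith
  exact_mod_cast Nat.eq_of_mul_eq_mul_left n.succ_pos h4

/-- The variance of the number of cherries is at most linear. -/
theorem sum_cherries_sub_sq_le (n : ℕ) :
    ∑ t ∈ treesOfNumNodesEq n, ((cherries t : ℝ) / (n + 1) - 1 / 4) ^ 2 ≤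
      (catalan n / (n + 1) : ℝ) := by
  -- The second factorial moment formula needs `4 ≤ n + 1`. For smaller `n` the squared deviation is
  -- at most `1 / 16`, below `1 / (n + 1)`.
  rcases lt_or_ge n 3 with hn | hn
  · have : ∀ t ∈ treesOfNumNodesEq n, ((cherries t : ℝ) / (n + 1) - 1 / 4) ^ 2 ≤ 1 / (n + 1) := by
      intro t ht
      have h := two_mul_cherries_le t
      rw [BinaryTree.numLeaves_eq_numNodes_succ, BinaryTree.mem_treesOfNumNodesEq.1 ht] at h
      have h' : (2 * cherries t : ℝ) ≤ n + 1 := by exact_mod_cast h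
      have h0 : (0 : ℝ) ≤ cherries t / (n + 1) := by positivity
      have h1 : (cherries t / (n + 1) : ℝ) ≤ 1 / 2 := by
        rw [div_le_iff₀ (by positivity)]
        linarith
      have h2 : (1 / 3 : ℝ) ≤ 1 / (n + 1) := by
        have : (n : ℝ) + 1 ≤ 3 := by exact_mod_cast hn
        exact one_div_le_one_div_of_le (by positivity) this
      nlinarith
    refine (Finset.sum_le_sum this).trans (le_of_eq ?_)
    rw [Finset.sum_const, BinaryTree.treesOfNumNodesEq_card_eq_catalan, nsmul_eq_mul,
      mul_one_div]
  · obtain ⟨k, rfl⟩ : ∃ k, n = k + 2 := ⟨n - 2, by omega⟩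
    have s1 := sum_cherries_choose (n := k + 2) (q := 1) (by omega)
    have s2 := sum_cherries_choose (n := k + 2) (q := 2) (by omega)
    simp only [Nat.choose_one_right, Nat.add_sub_cancel, Nat.cast_choose_two,
      show k + 2 - 1 = k + 1 by omega, show k + 2 + 1 - 2 = k + 1 by omega] at s1 s2
    have c1 := add_two_mul_catalan_succ k
    have c2 := add_two_mul_catalan_succ (k + 1)
    push_cast at s1 s2 c1 c2 ⊢
    rw [show k + 1 + 1 = k + 2 by ring] at c2
    have s0 : ∑ t ∈ treesOfNumNodesEq (k + 2), (1 : ℝ) = catalan (k + 2) := by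
      rw [Finset.sum_const, BinaryTree.treesOfNumNodesEq_card_eq_catalan, nsmul_eq_mul, mul_one]
    -- The square is expanded in the binomial moments of orders two, one and zero, which are known
    -- exactly.
    have e : ∑ t ∈ treesOfNumNodesEq (k + 2), ((cherries t : ℝ) / (k + 2 + 1) - 1 / 4) ^ 2 =
        (2 * ∑ t ∈ treesOfNumNodesEq (k + 2), (cherries t : ℝ) * (cherries t - 1) / 2 +
          (1 - (k + 3) / 2) * ∑ t ∈ treesOfNumNodesEq (k + 2), (cherries t : ℝ) +
          (k + 3) ^ 2 / 16 * ∑ t ∈ treesOfNumNodesEq (k + 2), (1 : ℝ)) / (k + 3) ^ 2 := by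
      rw [Finset.mul_sum, Finset.mul_sum, Finset.mul_sum, ← Finset.sum_add_distrib,
        ← Finset.sum_add_distrib, Finset.sum_div]
      refine Finset.sum_congr rfl fun t _ => ?_
      have : (k + 3 : ℝ) ≠ 0 := by positivity
      rw [show (k : ℝ) + 2 + 1 = k + 3 by ring]
      field_simp
      ring
    rw [e, s0, s1, s2, div_le_div_iff₀ (by positivity) (by positivity)]
    have d1 : (catalan (k + 1) : ℝ) = 2 * (2 * k + 1) * catalan k / (k + 2) := by
      rw [eq_div_iff (by positivity), ← c1]
      ring
    have d2 : (catalan (k + 2) : ℝ) = 2 * (2 * (k + 1) + 1) * catalan (k + 1) / (k + 3) := by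
      rw [eq_div_iff (by positivity), ← c2]
      ring
    rw [d2, d1]
    rw [← sub_nonneg]
    -- With all Catalan numbers expressed through `catalan k`, this visibly nonnegative quantity is
    -- exactly the difference of the two sides.
    refine (show (0 : ℝ) ≤ catalan k * (k + 3) / (k + 2) *
      (15 * k ^ 2 + 121 / 4 * k + 47 / 4) by positivity).trans_eq ?_
    field_simp
    ring

/-! ### From weights to measures, and the conclusion. -/

/-- Comparison of the uniform measure on a finite set with a measure whose density is, on average,
close to a constant. -/
theorem weighted_vs_uniform {Ω : Type*} [Fintype Ω] [Nonempty Ω] {f g : Ω → ℝ} {K c ε₁ ε₂ : ℝ}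
    (hg1 : ∀ x, 1 ≤ g x) (hgf : ∀ x, g x ≤ f x) (hgK : ∀ x, g x ≤ K)
    (h1 : ∑ x, (f x - g x) ≤ Fintype.card Ω * ε₁) (h2 : ∑ x, |g x - c| ≤ Fintype.card Ω * ε₂)
    (A : Finset Ω) :
    (∑ x ∈ A, f x) / ∑ x, f x ≤ K * ((∑ _x ∈ A, (1 : ℝ)) / Fintype.card Ω) + ε₁ ∧
    (∑ _x ∈ A, (1 : ℝ)) / Fintype.card Ω ≤ (K + ε₁) * ((∑ x ∈ A, f x) / ∑ x, f x) ∧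
    |(∑ x ∈ A, f x) / ∑ x, f x - (∑ _x ∈ A, (1 : ℝ)) / Fintype.card Ω| ≤ 2 * (ε₁ + ε₂) := by
  set N : ℝ := (Fintype.card Ω : ℝ) with hN
  have hN0 : 0 < N := by
    rw [hN]
    exact_mod_cast Fintype.card_pos
  have hone : ∑ _x : Ω, (1 : ℝ) = N := by simp [hN]
  set F := ∑ x, f x
  set FA := ∑ x ∈ A, f x
  set a := ∑ _x ∈ A, (1 : ℝ) with ha
  have ha0 : 0 ≤ a := Finset.sum_nonneg fun _ _ => zero_le_one
  have haN : a ≤ N := by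
    rw [← hone]
    exact Finset.sum_le_univ_sum_of_nonneg fun _ => zero_le_one
  have hNF : N ≤ F := by
    rw [← hone]
    exact Finset.sum_le_sum fun x _ => (hg1 x).trans (hgf x)
  have haFA : a ≤ FA := Finset.sum_le_sum fun x _ => (hg1 x).trans (hgf x)
  have hF0 : 0 < F := hN0.trans_le hNF
  have hFA0 : 0 ≤ FA := ha0.trans haFA
  have hFAle : FA ≤ K * a + N * ε₁ := by
    calc FA = ∑ x ∈ A, g x + ∑ x ∈ A, (f x - g x) := by
          rw [← Finset.sum_add_distrib]
          exact Finset.sum_congr rfl fun x _ => by ring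
      _ ≤ ∑ x ∈ A, K * 1 + ∑ x, (f x - g x) := by
          refine add_le_add (Finset.sum_le_sum fun x _ => by rw [mul_one]; exact hgK x) ?_
          exact Finset.sum_le_univ_sum_of_nonneg fun x => sub_nonneg.2 (hgf x)
      _ ≤ K * a + N * ε₁ := by
          rw [← Finset.mul_sum]
          exact add_le_add_right h1 _
  have hFle : F ≤ N * (K + ε₁) := by
    calc F = ∑ x, g x + ∑ x, (f x - g x) := by
          rw [← Finset.sum_add_distrib]
          exact Finset.sum_congr rfl fun x _ => by ring
      _ ≤ ∑ x, K * 1 + N * ε₁ :=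
          add_le_add (Finset.sum_le_sum fun x _ => by rw [mul_one]; exact hgK x) h1
      _ = N * (K + ε₁) := by
          rw [← Finset.mul_sum, hone]
          ring
  have hdev : ∑ x, |f x - c| ≤ N * (ε₁ + ε₂) := by
    calc ∑ x, |f x - c| ≤ ∑ x, ((f x - g x) + |g x - c|) := by
          refine Finset.sum_le_sum fun x _ => ?_
          rw [← abs_of_nonneg (sub_nonneg.2 (hgf x))]
          exact abs_sub_le _ _ _
      _ ≤ N * ε₁ + N * ε₂ := by
          rw [Finset.sum_add_distrib]
          exact add_le_add h1 h2
      _ = N * (ε₁ + ε₂) := by ring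
  have hdevA : ∀ B : Finset Ω, |∑ x ∈ B, (f x - c)| ≤ N * (ε₁ + ε₂) := fun B =>
    (Finset.abs_sum_le_sum_abs _ _).trans
      ((Finset.sum_le_univ_sum_of_nonneg fun _ => abs_nonneg _).trans hdev)
  refine ⟨?_, ?_, ?_⟩
  · calc FA / F ≤ FA / N := div_le_div_of_nonneg_left hFA0 hN0 hNF
      _ ≤ (K * a + N * ε₁) / N := div_le_div_of_nonneg_right hFAle hN0.le
      _ = K * (a / N) + ε₁ := by field_simp
  · rw [div_le_iff₀ hN0]
    calc a ≤ FA := haFA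
      _ = F * (FA / F) := by field_simp
      _ ≤ N * (K + ε₁) * (FA / F) := mul_le_mul_of_nonneg_right hFle (by positivity)
      _ = (K + ε₁) * (FA / F) * N := by ring
  · have e1 : FA = ∑ x ∈ A, (f x - c) + c * a := by
      rw [ha, Finset.mul_sum, ← Finset.sum_add_distrib]
      exact Finset.sum_congr rfl fun x _ => by ring
    have e2 : F = ∑ x, (f x - c) + c * N := by
      rw [← hone, Finset.mul_sum, ← Finset.sum_add_distrib]
      exact Finset.sum_congr rfl fun x _ => by ring
    have hA := hdevA A
    have hU := hdevA Finset.univ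
    -- Writing `f = (f - c) + c`, the contributions of the constant `c` cancel. Each remaining sum
    -- is at most `N * (ε₁ + ε₂)`, and `F ≥ N`.
    have e3 : FA / F - a / N =
        (∑ x ∈ A, (f x - c) - a / N * ∑ x, (f x - c)) / F := by
      rw [eq_div_iff hF0.ne', sub_mul, div_mul_cancel₀ _ hF0.ne']
      conv_lhs => rw [e1, e2]
      field_simp
      ring
    have haN1 : a / N ≤ 1 := (div_le_one hN0).2 haN
    have haN0 : 0 ≤ a / N := by positivity
    rw [e3, abs_div, abs_of_pos hF0, div_le_iff₀ hF0]
    have hε : 0 ≤ ε₁ + ε₂ := by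
      have := (abs_nonneg _).trans hU
      exact nonneg_of_mul_nonneg_right this hN0
    calc |∑ x ∈ A, (f x - c) - a / N * ∑ x, (f x - c)|
        ≤ |∑ x ∈ A, (f x - c)| + |a / N * ∑ x, (f x - c)| := abs_sub _ _
      _ ≤ N * (ε₁ + ε₂) + 1 * (N * (ε₁ + ε₂)) := by
          rw [abs_mul, abs_of_nonneg haN0]
          gcongr
      _ = 2 * (ε₁ + ε₂) * N := by ring
      _ ≤ 2 * (ε₁ + ε₂) * F := by gcongr

/-- The passage from the second to the first absolute moment uses `|x| ≤ (√N x² + 1/√N) / 2` with `N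
= n + 1`, a pointwise substitute for Cauchy–Schwarz. -/
theorem sum_abs_cherries_sub_le (n : ℕ) :
    ∑ t ∈ treesOfNumNodesEq n, |(cherries t : ℝ) / (n + 1) - 1 / 4| ≤
      catalan n / √(n + 1 : ℝ) := by
  have hn : (0 : ℝ) < n + 1 := by positivity
  have hs : 0 < √(n + 1 : ℝ) := Real.sqrt_pos.2 hn
  have hsq : √(n + 1 : ℝ) * √(n + 1 : ℝ) = n + 1 := Real.mul_self_sqrt hn.le
  have h : ∀ x : ℝ, |x| ≤ (√(n + 1 : ℝ) * x ^ 2 + 1 / √(n + 1 : ℝ)) / 2 := by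
    intro x
    rw [le_div_iff₀ two_pos, ← sq_abs x]
    have : √(n + 1 : ℝ) * |x| ^ 2 + 1 / √(n + 1 : ℝ) - |x| * 2 =
        (√(n + 1 : ℝ) * |x| - 1) ^ 2 / √(n + 1 : ℝ) := by
      field_simp
      ring
    have h0 : 0 ≤ (√(n + 1 : ℝ) * |x| - 1) ^ 2 / √(n + 1 : ℝ) := by positivity
    linarith
  refine (Finset.sum_le_sum fun t _ => h _).trans ?_
  rw [← Finset.sum_div, Finset.sum_add_distrib, ← Finset.mul_sum, Finset.sum_const,
    BinaryTree.treesOfNumNodesEq_card_eq_catalan, nsmul_eq_mul, div_le_iff₀ two_pos]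
  have h2 : √(n + 1 : ℝ) * (catalan n / (n + 1)) = catalan n / √(n + 1 : ℝ) := by
    rw [eq_div_iff hs.ne', mul_right_comm, hsq, mul_div_cancel₀ _ hn.ne']
  calc √(n + 1 : ℝ) * ∑ t ∈ treesOfNumNodesEq n, ((cherries t : ℝ) / (n + 1) - 1 / 4) ^ 2 +
        catalan n * (1 / √(n + 1 : ℝ))
      ≤ √(n + 1 : ℝ) * (catalan n / (n + 1)) + catalan n * (1 / √(n + 1 : ℝ)) := by
        gcongr
        exact sum_cherries_sub_sq_le n
    _ = catalan n / √(n + 1 : ℝ) * 2 := by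
        rw [h2]
        ring

theorem sum_planeTree_prod (n : ℕ) (F : BinaryTree Unit → BinaryTree Unit → ℝ) :
    ∑ p : PlaneTree (n + 1) × PlaneTree (n + 1), F p.1.tree p.2.tree =
      ∑ s ∈ treesOfNumNodesEq n, ∑ t ∈ treesOfNumNodesEq n, F s t := by
  rw [Fintype.sum_prod_type, ← sum_planeTree]
  exact Finset.sum_congr rfl fun s _ => sum_planeTree n (F s.tree)

theorem sum_abs_cherryWeight_sub_le (n : ℕ) :
    ∑ s ∈ treesOfNumNodesEq n, ∑ t ∈ treesOfNumNodesEq n,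
      |cherryWeight (n + 1) (cherries s) (cherries t) - Real.exp (1 / 8)| ≤
      catalan n ^ 2 * (8 * Real.exp 4 / √(n + 1 : ℝ)) := by
  have hn : (0 : ℝ) < n + 1 := by positivity
  have hs : 0 < √(n + 1 : ℝ) := Real.sqrt_pos.2 hn
  have hcher : ∀ s ∈ treesOfNumNodesEq n, 2 * cherries s ≤ n + 1 := fun s hs => by
    have := two_mul_cherries_le s
    rwa [BinaryTree.numLeaves_eq_numNodes_succ, BinaryTree.mem_treesOfNumNodesEq.1 hs] at this
  have h1 : ∀ s ∈ treesOfNumNodesEq n, ∀ t ∈ treesOfNumNodesEq n,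
      |cherryWeight (n + 1) (cherries s) (cherries t) - Real.exp (1 / 8)| ≤
      (6 / √(n + 1 : ℝ) + (|(cherries s : ℝ) / (n + 1) - 1 / 4| +
        |(cherries t : ℝ) / (n + 1) - 1 / 4|)) * Real.exp 4 := by
    intro s hs t ht
    have h := abs_cherryWeight_sub_le (hcher s hs) (hcher t ht) n.succ_pos
    push_cast at h
    refine h.trans ?_
    have : √(n + 1 : ℝ) ≤ n + 1 := Real.sqrt_le_iff.2
      ⟨hn.le, by nlinarith [Nat.cast_nonneg (α := ℝ) n]⟩
    gcongr
  refine (Finset.sum_le_sum fun s hs => Finset.sum_le_sum fun t ht => h1 s hs t ht).trans ?_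
  have h2 := sum_abs_cherries_sub_le n
  simp only [← Finset.sum_mul, Finset.sum_add_distrib, Finset.sum_const, nsmul_eq_mul,
    BinaryTree.treesOfNumNodesEq_card_eq_catalan, ← Finset.mul_sum]
  set D := ∑ t ∈ treesOfNumNodesEq n, |(cherries t : ℝ) / (n + 1) - 1 / 4| with hD
  calc (catalan n * catalan n * (6 / √(n + 1 : ℝ)) + (catalan n * D + catalan n * D)) *
        Real.exp 4
      ≤ (catalan n * catalan n * (6 / √(n + 1 : ℝ)) +
        (catalan n * (catalan n / √(n + 1 : ℝ)) + catalan n * (catalan n / √(n + 1 : ℝ)))) *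
        Real.exp 4 := by gcongr
    _ = catalan n ^ 2 * (8 * Real.exp 4 / √(n + 1 : ℝ)) := by ring

/-- `weighted_vs_uniform` is applied with `f` the normalized intertwining count, `g` the cherry
weight, upper bound `e` and typical value `exp (1 / 8)`. The normalization by `(n + 1)!` cancels in
the ratio defining `nuT`. -/
theorem nuT_nuP_compare (n : ℕ) (S : Set (BinTree (n + 1) × BinTree (n + 1))) :
    (nuT (n + 1)).real S ≤
      Real.exp 1 * (nuP (n + 1)).real S + 6 * Real.exp 65536 / (n + 1) ∧
    (nuP (n + 1)).real S ≤
      (Real.exp 1 + 6 * Real.exp 65536 / (n + 1)) * (nuT (n + 1)).real S ∧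
    |(nuT (n + 1)).real S - (nuP (n + 1)).real S| ≤
      2 * (6 * Real.exp 65536 / (n + 1) + 8 * Real.exp 4 / √(n + 1 : ℝ)) := by
  classical
  have hleaves : ∀ t : PlaneTree (n + 1), 2 * cherries t.tree ≤ n + 1 := fun t =>
    (two_mul_cherries_le t.tree).trans_eq t.numLeaves_eq
  have hcard : (Fintype.card (PlaneTree (n + 1) × PlaneTree (n + 1)) : ℝ) = catalan n ^ 2 := by
    rw [Fintype.card_prod, card_planeTree, Nat.cast_mul, pow_two]
  have key := weighted_vs_uniform (Ω := PlaneTree (n + 1) × PlaneTree (n + 1))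
    (f := fun p => intertwineCount p.1.tree p.2.tree / (n + 1)!)
    (g := fun p => cherryWeight (n + 1) (cherries p.1.tree) (cherries p.2.tree))
    (c := Real.exp (1 / 8)) (ε₁ := 6 * Real.exp 65536 / (n + 1))
    (ε₂ := 8 * Real.exp 4 / √(n + 1 : ℝ))
    (fun p => one_le_cherryWeight)
    (fun p => cherryWeight_le_intertwineCount p.1.numLeaves_eq p.2.numLeaves_eq)
    (fun p => cherryWeight_le (hleaves p.1) (hleaves p.2))
    (by
      rw [hcard, sum_planeTree_prod n fun s t => (intertwineCount s t / (n + 1)! : ℝ) -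
        cherryWeight (n + 1) (cherries s) (cherries t)]
      exact sum_intertwineCount_sub_cherryWeight_le n)
    (by
      rw [hcard, sum_planeTree_prod n fun s t =>
        |cherryWeight (n + 1) (cherries s) (cherries t) - Real.exp (1 / 8)|]
      exact sum_abs_cherryWeight_sub_le n)
    (Finset.univ.filter fun p => (p.1.toBinTree, p.2.toBinTree) ∈ S)
  have hfac : ((n + 1)! : ℝ) ≠ 0 := by positivity
  rw [← Finset.sum_div, ← Finset.sum_div, div_div_div_cancel_right₀ hfac, ← nuT_real S,
    ← nuP_real S] at key
  exact key

theorem tvDist_le {α : Type*} [MeasurableSpace α] {μ ν : Measure α} {r : ℝ}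
    (h : ∀ S : Set α, |μ.real S - ν.real S| ≤ r) : tvDist μ ν ≤ r := by
  have : Nonempty {S : Set α // MeasurableSet S} := ⟨⟨∅, .empty⟩⟩
  exact ciSup_le fun S => h S.1

theorem tvDist_nonneg {α : Type*} [MeasurableSpace α] (μ ν : Measure α) : 0 ≤ tvDist μ ν :=
  Real.iSup_nonneg fun _ => abs_nonneg _

theorem tvDist_nuT_nuP_le {n : ℕ} (hn : 1 ≤ n) :
    tvDist (nuT n) (nuP n) ≤
      (2 * (6 * Real.exp 65536 + 8 * Real.exp 4)) * (n : ℝ) ^ (-(1 / 2) : ℝ) := by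
  obtain ⟨n, rfl⟩ := Nat.exists_eq_add_of_le' hn
  refine tvDist_le fun S => (nuT_nuP_compare n S).2.2.trans ?_
  have h1 : (1 : ℝ) ≤ n + 1 := by linarith [Nat.cast_nonneg (α := ℝ) n]
  have hs : 0 < √(n + 1 : ℝ) := Real.sqrt_pos.2 (by positivity)
  have h2 : √(n + 1 : ℝ) ≤ n + 1 := Real.sqrt_le_iff.2 ⟨by positivity, by nlinarith⟩
  have h3 : ((n + 1 : ℕ) : ℝ) ^ (-(1 / 2) : ℝ) = 1 / √(n + 1 : ℝ) := by
    rw [Real.rpow_neg (by positivity), ← Real.sqrt_eq_rpow, one_div]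
    push_cast
    rfl
  rw [h3]
  calc 2 * (6 * Real.exp 65536 / (n + 1) + 8 * Real.exp 4 / √(n + 1 : ℝ))
      ≤ 2 * (6 * Real.exp 65536 / √(n + 1 : ℝ) + 8 * Real.exp 4 / √(n + 1 : ℝ)) := by gcongr
    _ = _ := by ring

theorem theorem1 :
    (Tendsto (fun n : ℕ => tvDist (nuT n) (nuP n)) atTop (nhds 0) ∧
      ∃ C : ℝ, ∀ n : ℕ, 1 ≤ n → tvDist (nuT n) (nuP n) ≤ C * (n : ℝ) ^ (-(1 / 2) : ℝ)) ∧
    ∃ M₁ M₂ C : ℝ, 0 < M₁ ∧ 0 < M₂ ∧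
      ∀ n : ℕ, 1 ≤ n → ∀ S : Set (BinTree n × BinTree n),
        (nuT n).real S ≤ M₁ * (nuP n).real S + C * (n : ℝ)⁻¹ ∧
        (nuP n).real S ≤ M₂ * (nuT n).real S + C * (n : ℝ)⁻¹ := by
  -- The second constant absorbs the `1 / (n + 1)` error of the multiplicative bound for `nuP`, so
  -- the additive term is slack in that inequality.
  refine ⟨⟨?_, _, fun n hn => tvDist_nuT_nuP_le hn⟩, Real.exp 1,
    Real.exp 1 + 6 * Real.exp 65536, 6 * Real.exp 65536, by positivity, by positivity, ?_⟩
  · refine squeeze_zero' (.of_forall fun n => tvDist_nonneg _ _)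
      ((eventually_ge_atTop 1).mono fun n hn => tvDist_nuT_nuP_le hn) ?_
    have h := (tendsto_rpow_neg_atTop (show (0 : ℝ) < 1 / 2 by norm_num)).comp
      tendsto_natCast_atTop_atTop
    simpa using h.const_mul (2 * (6 * Real.exp 65536 + 8 * Real.exp 4))
  · intro n hn S
    obtain ⟨n, rfl⟩ := Nat.exists_eq_add_of_le' hn
    obtain ⟨h1, h2, -⟩ := nuT_nuP_compare n S
    push_cast
    refine ⟨h1, h2.trans ?_⟩
    have h3 : 6 * Real.exp 65536 / (n + 1 : ℝ) ≤ 6 * Real.exp 65536 :=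
      div_le_self (by positivity) (by linarith [Nat.cast_nonneg (α := ℝ) n])
    have h4 : 0 ≤ 6 * Real.exp 65536 * (n + 1 : ℝ)⁻¹ := by positivity
    refine le_trans ?_ (le_add_of_nonneg_right h4)
    gcongr
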